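/- Let $X$ be a compact metric space with Borel $\sigma$-algebra $\mathcal B_X$, let $T$ be an action of $\mathbb Z^2$ on $X$ by homeomorphisms $T^{w}$, $w\in\mathbb Z^2$, and let $\mu$ be a $T$-invariant Borel probability measure on $X$. Let $\vec v=(1,\beta)$ with $\beta\in\mathbb R$, and for $b>0$ put $$\Lambda^{\vec v}(b)=\{(m,n)\in\mathbb Z^2:\ \beta m-b/2\le n\le \beta m+b/2\}.$$ The $\vec v$-directional Kronecker algebra is $$\mathcal K_\mu^{\vec v}=\Big\{B\in\mathcal B_X:\ \overline{\{1_B\circ T^{w}: w\in\Lambda^{\vec v}(b_0)\}}\ \text{is compact in } L^2(X,\mathcal B_X,\mu)\Big\},$$ where $b_0>0$ is arbitrary, and the system $(X,\mathcal B_X,\mu,T)$ is called $\vec v$-weak mixing if $\mathcal K_\mu^{\vec v}=\{\emptyset,X\}$ up to null sets, i.e. every $B\in\mathcal K_\mu^{\vec v}$ has $\mu(B)\in\{0,1\}$. (The theorem holds for every choice of $b_0>0$ in this definition.) For a finite measurable partition $\alpha$ of $X$ let $H_\mu(\alpha)=-\sum_{A\in\alpha}\mu(A)\log\mu(A)$ (with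 $0\log 0=0$); call $\alpha$ nontrivial if some $A\in\alpha$ satisfies $0<\mu(A)<1$. A directional sequence in $\Lambda^{\vec v}(b)$ is an infinite subset $S=\{(m_i,n_i)\}_{i=1}^\infty$ of $\Lambda^{\vec v}(b)$ such that $(m_i)_{i\ge1}$ is strictly monotone (increasing or decreasing), and for such $S$ $$h_\mu^S(T,\alpha)=\limsup_{k\to\infty}\frac1k H_\mu\Big(\bigvee_{i=1}^k T^{-(m_i,n_i)}\alpha\Big).$$ **Theorem.** The following three conditions are equivalent. (a) $(X,\mathcal B_X,\mu,T)$ is $\vec v$-weak mixing. (b) For every $B\in\mathcal B_X$ with $0<\mu(B)<1$ and every $b\in(0,\infty)$ there is a directional sequence $S$ in $\Lambda^{\vec v}(b)$ with $h_\mu^S(T,\{B,B^c\})>0$. (c) For every nontrivial finite measurable partition $\alpha$ of $X$ and every $b\in(0,\infty)$ there is a directional sequence $S$ in $\Lambda^{\vec v}(b)$ with $h_\mu^S(T,\alpha)>0$. Moreover, for each fixed $b\in(0,\infty)$, condition (a) is equivalent to condition (b) for this single value of $b$, and also to condition (c) for this single value of $b$. -/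

import Mathlib

open MeasureTheory Filter

/-- The strip `Λ^v(b) = {(m, n) ∈ ℤ² : β m - b/2 ≤ n ≤ β m + b/2}` around the line in the
direction `v = (1, β)`. -/
def directionalStrip (β b : ℝ) : Set (ℤ × ℤ) :=
  {w | β * (w.1 : ℝ) - b / 2 ≤ (w.2 : ℝ) ∧ (w.2 : ℝ) ≤ β * (w.1 : ℝ) + b / 2}

/-- `A` is a finite measurable partition of `X`, given as a finite indexed family of cells
(some of which may be empty). -/
structure IsMeasurablePartition {X : Type*} [MeasurableSpace X] {ι : Type*} [Fintype ι]
    (A : ι → Set X) : Prop where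
  measurableSet : ∀ i, MeasurableSet (A i)
  pairwise_disjoint : Pairwise fun i j => Disjoint (A i) (A j)
  iUnion_eq_univ : ⋃ i, A i = Set.univ

/-- Shannon entropy `H_μ(α) = - ∑ μ(A) log μ(A)`, natural logarithm, `0 log 0 = 0`. -/
noncomputable def partitionEntropy {X : Type*} [MeasurableSpace X] (μ : Measure X)
    {ι : Type*} [Fintype ι] (A : ι → Set X) : ℝ :=
  - ∑ i, μ.real (A i) * Real.log (μ.real (A i))

/-- The join `⋁_{i < k} T^{-s i} α`, where `T^w` is `x ↦ w +ᵥ x`: its cells are the sets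
`⋂_{i < k} T^{-s i} A_{f i}`, indexed by `f : Fin k → ι`. -/
def sequenceJoin {X : Type*} [AddAction (ℤ × ℤ) X] {ι : Type*}
    (s : ℕ → ℤ × ℤ) (A : ι → Set X) (k : ℕ) (f : Fin k → ι) : Set X :=
  ⋂ i : Fin k, (fun x : X => s i +ᵥ x) ⁻¹' A (f i)

/-- The sequence entropy `h^S_μ(T, α) = limsup_k (1/k) H_μ(⋁_{i < k} T^{-s i} α)` along
`S = {s 0, s 1, …}`. The limsup is taken in the extended reals. -/
noncomputable def sequenceEntropy {X : Type*} [MeasurableSpace X] [AddAction (ℤ × ℤ) X]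
    (μ : Measure X) {ι : Type*} [Fintype ι] (s : ℕ → ℤ × ℤ) (A : ι → Set X) : EReal :=
  limsup (fun k : ℕ => ((1 / (k : ℝ) * partitionEntropy μ (sequenceJoin s A k) : ℝ) : EReal))
    atTop

/-- `s` enumerates an infinite subset `{(m_i, n_i)}` of the strip `Λ^v(b)` for which the
sequence `(m_i)` is strictly monotone. -/
structure IsDirectionalSequence (β b : ℝ) (s : ℕ → ℤ × ℤ) : Prop where
  mem_strip : ∀ i, s i ∈ directionalStrip β b
  strictly_monotone : StrictMono (fun i => (s i).1) ∨ StrictAnti (fun i => (s i).1)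

section Koopman

variable {X : Type*} [MeasurableSpace X] [AddAction (ℤ × ℤ) X] [MeasurableConstVAdd (ℤ × ℤ) X]
  (μ : Measure X) [VAddInvariantMeasure (ℤ × ℤ) X μ]

/-- The Koopman operator `U_T^w f = f ∘ T^w` on the complex Hilbert space `L²(μ)`. -/
noncomputable def koopman (w : ℤ × ℤ) : Lp ℂ 2 μ →ₗᵢ[ℂ] Lp ℂ 2 μ :=
  Lp.compMeasurePreservingₗᵢ ℂ (fun x : X => w +ᵥ x) (measurePreserving_vadd w μ)

/-- The directional Kronecker algebra of `μ` in the direction `(1, β)`: the measurable sets `B`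
such that the closure of `{U_T^w 1_B : w ∈ Λ^v(b)}` is compact in `L²(μ)`. -/
def directionalKronecker [IsFiniteMeasure μ] (β b : ℝ) : Set (Set X) :=
  {B | ∃ hB : MeasurableSet B, IsCompact (closure
    ((fun w => koopman μ w (indicatorConstLp 2 hB (measure_ne_top μ B) (1 : ℂ))) ''
      directionalStrip β b))}

/-- Directional weak mixing: the directional Kronecker algebra is trivial, that is, equal to
`{∅, X}` up to null sets. -/
def IsDirectionalWeakMixing [IsFiniteMeasure μ] (β b : ℝ) : Prop :=
  ∀ B ∈ directionalKronecker μ β b, μ B = 0 ∨ μ Bᶜ = 0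

end Koopman

/-! From (c) to (b) the partition `{B, Bᶜ}` suffices. All strips with slope β and positive width are
covered by finitely many translates of one another, so the Kronecker algebra does not depend on the
width; this is why a single width is enough.

(b) ⇒ (a). If `B` is in the Kronecker algebra, its translates along any strip lie within small
measure of finitely many fixed translates. The first `k` translates along a sequence are then coded
by those fixed sets together with `k` error sets of small entropy, so the join has entropy at most a
constant plus `k * (η / 2)` and the sequence entropy is nonpositive
(`sequenceEntropy_nonpos_of_mem_directionalKronecker`).

(a) ⇒ (c). Averaging the rank one operators of `U^w f` over lattice points close to the line gives a
Hilbert–Schmidt operator `K`. A strip element conjugates `K` into a norm-continuous one-parameter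
family of such operators, so `K g` has a totally bounded strip orbit
(`exists_totallyBounded_orbit`). For `f` of mean zero, `K g` has mean zero too, and weak mixing
forces it to vanish because its superlevel sets lie in the Kronecker algebra
(`IsDirectionalWeakMixing.eq_zero`). Hence the weighted averages of `|⟪U^w f, g⟫|²` tend to zero,
and as points close to the line have positive lower density, some far point makes finitely many
correlations small. Choosing such points greedily makes each new translate of the partition almost
independent of the preceding join, so each step adds at least half of `H(α)`. -/

open Topology

section TotallyBounded

/-- A set that is approximated arbitrarily well by totally bounded sets is totally bounded. -/
theorem totallyBounded_of_approx {E : Type*} [PseudoMetricSpace E] {S : Set E}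
    (h : ∀ ε > 0, ∃ S' : Set E, TotallyBounded S' ∧ ∀ x ∈ S, ∃ y ∈ S', dist x y < ε) :
    TotallyBounded S := by
  rw [Metric.totallyBounded_iff]
  intro ε hε
  obtain ⟨S', hS', happ⟩ := h (ε / 2) (half_pos hε)
  obtain ⟨t, ht, hcov⟩ := Metric.totallyBounded_iff.1 hS' (ε / 2) (half_pos hε)
  refine ⟨t, ht, fun x hx => ?_⟩
  obtain ⟨y, hy, hxy⟩ := happ x hx
  obtain ⟨z, hz, hyz⟩ := Set.mem_iUnion₂.1 (hcov hy)
  refine Set.mem_iUnion₂.2 ⟨z, hz, ?_⟩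
  rw [Metric.mem_ball] at hyz ⊢
  linarith [dist_triangle x y z]

end TotallyBounded

/-! ### Cesàro averages and their shift invariance. -/

section Cesaro

/-- The Cesàro average of `a` over `0, …, N - 1`. -/
noncomputable def cesaroAvg (a : ℤ → ℂ) (N : ℕ) : ℂ :=
  (N : ℂ)⁻¹ * ∑ m ∈ Finset.range N, a m

theorem norm_cesaroAvg_le {a : ℤ → ℂ} {C : ℝ} (hC : ∀ m, ‖a m‖ ≤ C) (N : ℕ) :
    ‖cesaroAvg a N‖ ≤ C := by
  have hC0 : 0 ≤ C := (norm_nonneg _).trans (hC 0)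
  rcases Nat.eq_zero_or_pos N with rfl | hN
  · simpa [cesaroAvg] using hC0
  · have hN' : (0 : ℝ) < N := by exact_mod_cast hN
    rw [cesaroAvg, norm_mul, norm_inv, Complex.norm_natCast, inv_mul_le_iff₀ hN']
    refine (norm_sum_le _ _).trans ((Finset.sum_le_card_nsmul _ _ C fun m _ => hC _).trans ?_)
    simp

theorem cesaroAvg_add (a b : ℤ → ℂ) (N : ℕ) :
    cesaroAvg (fun m => a m + b m) N = cesaroAvg a N + cesaroAvg b N := by
  simp [cesaroAvg, Finset.sum_add_distrib, mul_add]

theorem cesaroAvg_const_mul (c : ℂ) (a : ℤ → ℂ) (N : ℕ) :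
    cesaroAvg (fun m => c * a m) N = c * cesaroAvg a N := by
  simp [cesaroAvg, ← Finset.mul_sum]; ring

theorem cesaroAvg_sub (a b : ℤ → ℂ) (N : ℕ) :
    cesaroAvg (fun m => a m - b m) N = cesaroAvg a N - cesaroAvg b N := by
  simp [cesaroAvg, Finset.sum_sub_distrib, mul_sub]

theorem cesaroAvg_sum {ι : Type*} (s : Finset ι) (a : ι → ℤ → ℂ) (N : ℕ) :
    cesaroAvg (fun m => ∑ i ∈ s, a i m) N = ∑ i ∈ s, cesaroAvg (a i) N := by
  simp only [cesaroAvg, ← Finset.mul_sum]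
  rw [Finset.sum_comm]

theorem tendsto_cesaroAvg_shift_one {a : ℤ → ℂ} {C : ℝ} (hC : ∀ m, ‖a m‖ ≤ C) :
    Tendsto (fun N => cesaroAvg (fun m => a (m + 1)) N - cesaroAvg a N) atTop (𝓝 0) := by
  have key : ∀ N, cesaroAvg (fun m => a (m + 1)) N - cesaroAvg a N
      = (N : ℂ)⁻¹ * (a N - a 0) := by
    intro N
    rw [← Nat.cast_zero, cesaroAvg, cesaroAvg, ← mul_sub, ← Finset.sum_sub_distrib]
    congr 1
    simpa using Finset.sum_range_sub (fun m : ℕ => a m) N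
  rw [tendsto_zero_iff_norm_tendsto_zero]
  refine squeeze_zero (fun _ => norm_nonneg _) (g := fun N : ℕ => (N : ℝ)⁻¹ * (C + C)) ?_ ?_
  · intro N
    rw [key, norm_mul, norm_inv, Complex.norm_natCast]
    gcongr
    exact (norm_sub_le _ _).trans (add_le_add (hC _) (hC _))
  · simpa using (tendsto_inv_atTop_nhds_zero_nat (𝕜 := ℝ)).mul_const (C + C)

theorem tendsto_cesaroAvg_shift {a : ℤ → ℂ} {C : ℝ} (hC : ∀ m, ‖a m‖ ≤ C) (p : ℤ) :
    Tendsto (fun N => cesaroAvg (fun m => a (m + p)) N - cesaroAvg a N) atTop (𝓝 0) := by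
  induction p using Int.induction_on with
  | zero => simp
  | succ i ih =>
    have h := (tendsto_cesaroAvg_shift_one (a := fun m => a (m + i)) fun m => hC _).add ih
    simpa [add_assoc, add_comm, add_left_comm] using h
  | pred i ih =>
    have h := ih.sub (tendsto_cesaroAvg_shift_one (a := fun m => a (m + (-i - 1))) fun m => hC _)
    simp only [sub_zero] at h
    refine h.congr fun N => ?_
    have : (fun m : ℤ => a (m + 1 + (-i - 1))) = fun m => a (m + -i) := by
      funext m; congr 1; ring
    rw [this]; ring

theorem exists_tendsto_cesaroAvg {a : ℤ → ℂ} {C : ℝ} (hC : ∀ m, ‖a m‖ ≤ C) :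
    ∃ z : ℂ, ‖z‖ ≤ C ∧ Tendsto (cesaroAvg a) (hyperfilter ℕ) (𝓝 z) := by
  obtain ⟨z, hz, hle⟩ := (isCompact_closedBall (0 : ℂ) C).ultrafilter_le_nhds
    ((hyperfilter ℕ).map (cesaroAvg a)) (by
      rw [le_principal_iff, Ultrafilter.coe_map, mem_map]
      exact Filter.Eventually.of_forall fun N => by
        simpa using norm_cesaroAvg_le hC N)
  exact ⟨z, by simpa using hz, hle⟩

end Cesaro

/-! ### Weak limits of averaged rank one operators, and their compactness. -/

section MeanOperator

variable {H : Type*} [NormedAddCommGroup H] [InnerProductSpace ℂ H]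

/-- `K` is the weak limit, along the hyperfilter, of the Cesàro averages of the weighted rank one
operators `x ↦ a m • ⟪u m, x⟫ • u m`. -/
def IsMeanOperator (a : ℤ → ℝ) (u : ℤ → H) (K : H →L[ℂ] H) : Prop :=
  ∀ x y, Tendsto (cesaroAvg fun m => (a m : ℂ) * (inner ℂ x (u m) * inner ℂ (u m) y))
    (hyperfilter ℕ) (𝓝 (inner ℂ (K x) y))

theorem norm_weighted_inner_mul_inner_le {a : ℤ → ℝ} {u : ℤ → H} {A R : ℝ}
    (ha : ∀ m, |a m| ≤ A) (hu : ∀ m, ‖u m‖ ≤ R) (x y : H) (m : ℤ) :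
    ‖(a m : ℂ) * (inner ℂ x (u m) * inner ℂ (u m) y)‖ ≤ A * R ^ 2 * ‖x‖ * ‖y‖ := by
  have hA : 0 ≤ A := (abs_nonneg _).trans (ha 0)
  have hR : 0 ≤ R := (norm_nonneg _).trans (hu 0)
  rw [norm_mul, norm_mul, Complex.norm_real, Real.norm_eq_abs]
  calc |a m| * (‖inner ℂ x (u m)‖ * ‖inner ℂ (u m) y‖)
      ≤ A * ((‖x‖ * R) * (R * ‖y‖)) := by
        gcongr
        · exact ha m
        · exact (norm_inner_le_norm _ _).trans (by gcongr; exact hu m)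
        · exact (norm_inner_le_norm _ _).trans (by gcongr; exact hu m)
    _ = _ := by ring

/-- Bounded averages converge along a fixed ultrafilter for all pairs `x, y` at once, without
passing to subsequences. Uniqueness of limits makes the limiting form sesquilinear, and its
boundedness yields an operator. -/
theorem exists_isMeanOperator [CompleteSpace H] {a : ℤ → ℝ} {u : ℤ → H} {A R : ℝ}
    (ha : ∀ m, |a m| ≤ A) (hu : ∀ m, ‖u m‖ ≤ R) : ∃ K, IsMeanOperator a u K := by
  have hex := fun x y => exists_tendsto_cesaroAvg (norm_weighted_inner_mul_inner_le ha hu x y)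
  choose B hB hBt using hex
  let L : H →ₗ⋆[ℂ] H →ₗ[ℂ] ℂ := LinearMap.mk₂'ₛₗ (starRingEnd ℂ) (RingHom.id ℂ) B
    (fun x x' y => by
      refine tendsto_nhds_unique (hBt (x + x') y) (((hBt x y).add (hBt x' y)).congr fun N => ?_)
      rw [← cesaroAvg_add]; congr 1; funext m; rw [inner_add_left]; ring)
    (fun c x y => by
      refine tendsto_nhds_unique (hBt (c • x) y) (((hBt x y).const_mul _).congr fun N => ?_)
      rw [← cesaroAvg_const_mul]; congr 1; funext m; rw [inner_smul_left]; ring)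
    (fun x y y' => by
      refine tendsto_nhds_unique (hBt x (y + y')) (((hBt x y).add (hBt x y')).congr fun N => ?_)
      rw [← cesaroAvg_add]; congr 1; funext m; rw [inner_add_right]; ring)
    (fun c x y => by
      refine tendsto_nhds_unique (hBt x (c • y)) (((hBt x y).const_mul _).congr fun N => ?_)
      rw [← cesaroAvg_const_mul]; congr 1; funext m
      rw [inner_smul_right, RingHom.id_apply]; ring)
  refine ⟨InnerProductSpace.continuousLinearMapOfBilin (L.mkContinuous₂ (A * R ^ 2) hB), ?_⟩
  intro x y
  rw [InnerProductSpace.continuousLinearMapOfBilin_apply]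
  exact hBt x y

variable {a a' : ℤ → ℝ} {u : ℤ → H} {K K' : H →L[ℂ] H} {A R : ℝ}

theorem IsMeanOperator.sub (h : IsMeanOperator a u K) (h' : IsMeanOperator a' u K') :
    IsMeanOperator (fun m => a m - a' m) u (K - K') := by
  intro x y
  rw [sub_apply, inner_sub_left]
  refine ((h x y).sub (h' x y)).congr fun N => ?_
  rw [← cesaroAvg_sub]; congr 1; funext m; push_cast; ring

theorem IsMeanOperator.norm_le (h : IsMeanOperator a u K) (ha : ∀ m, |a m| ≤ A)
    (hu : ∀ m, ‖u m‖ ≤ R) : ‖K‖ ≤ A * R ^ 2 := by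
  have hA : 0 ≤ A := (abs_nonneg _).trans (ha 0)
  refine K.opNorm_le_bound (by positivity) fun x => ?_
  rcases eq_or_ne (K x) 0 with h0 | h0
  · rw [h0, norm_zero]; positivity
  have h1 : ‖inner ℂ (K x) (K x)‖ ≤ A * R ^ 2 * ‖x‖ * ‖K x‖ :=
    le_of_tendsto (h x (K x)).norm (Eventually.of_forall fun N =>
      norm_cesaroAvg_le (norm_weighted_inner_mul_inner_le ha hu x (K x)) N)
  rw [inner_self_eq_norm_sq_to_K, norm_pow] at h1
  simp only [Complex.coe_algebraMap, Complex.norm_real, norm_norm] at h1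
  have := norm_pos_iff.2 h0
  nlinarith

/-- Hilbert–Schmidt bound for mean operators. -/
theorem IsMeanOperator.sum_norm_sq_le (h : IsMeanOperator a u K) (ha : ∀ m, |a m| ≤ A)
    (hu : ∀ m, ‖u m‖ ≤ R) {ι : Type*} {e : ι → H} (he : Orthonormal ℂ e) (s : Finset ι) :
    ∑ i ∈ s, ‖K (e i)‖ ^ 2 ≤ (A * R ^ 2) ^ 2 := by
  have hA : 0 ≤ A := (abs_nonneg _).trans (ha 0)
  have hR : 0 ≤ R := (norm_nonneg _).trans (hu 0)
  set S : ℝ := ∑ i ∈ s, ‖K (e i)‖ ^ 2 with hS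
  have hS0 : 0 ≤ S := Finset.sum_nonneg fun _ _ => by positivity
  have hlim : Tendsto (cesaroAvg fun m => ∑ i ∈ s, (a m : ℂ) *
      (inner ℂ (e i) (u m) * inner ℂ (u m) (K (e i)))) (hyperfilter ℕ)
      (𝓝 (∑ i ∈ s, inner ℂ (K (e i)) (K (e i)))) := by
    refine (tendsto_finsetSum s fun i _ => h (e i) (K (e i))).congr fun N => ?_
    rw [cesaroAvg_sum]
  have hsum : ∑ i ∈ s, inner ℂ (K (e i)) (K (e i)) = (S : ℂ) := by
    rw [hS]; push_cast
    exact Finset.sum_congr rfl fun i _ => inner_self_eq_norm_sq_to_K _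
  -- Cauchy–Schwarz over `i` and Bessel's inequality for `u m` bound each term by a multiple of
  -- `√S`. In the limit `S` is bounded by the same multiple of `√S`, hence `S` is bounded
  -- independently of `s`.
  have hbound : ∀ m, ‖∑ i ∈ s, (a m : ℂ) * (inner ℂ (e i) (u m) * inner ℂ (u m) (K (e i)))‖
      ≤ A * R ^ 2 * √S := by
    intro m
    rw [← Finset.mul_sum, norm_mul, Complex.norm_real, Real.norm_eq_abs, mul_assoc]
    refine mul_le_mul (ha m) ?_ (norm_nonneg _) hA
    calc ‖∑ i ∈ s, inner ℂ (e i) (u m) * inner ℂ (u m) (K (e i))‖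
        ≤ ∑ i ∈ s, ‖inner ℂ (e i) (u m)‖ * (R * ‖K (e i)‖) := by
          refine (norm_sum_le _ _).trans (Finset.sum_le_sum fun i _ => ?_)
          rw [norm_mul]
          gcongr
          exact (norm_inner_le_norm _ _).trans (by gcongr; exact hu m)
      _ ≤ √(∑ i ∈ s, ‖inner ℂ (e i) (u m)‖ ^ 2) * √(∑ i ∈ s, (R * ‖K (e i)‖) ^ 2) :=
          Real.sum_mul_le_sqrt_mul_sqrt _ _ _
      _ ≤ √(R ^ 2) * √(R ^ 2 * S) := by
          refine mul_le_mul (Real.sqrt_le_sqrt ?_) (Real.sqrt_le_sqrt (le_of_eq ?_))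
            (Real.sqrt_nonneg _) (Real.sqrt_nonneg _)
          · exact (he.sum_inner_products_le (u m)).trans (by gcongr; exact hu m)
          · rw [hS, Finset.mul_sum]; simp [mul_pow]
      _ = R ^ 2 * √S := by
          rw [Real.sqrt_mul (by positivity), Real.sqrt_sq hR]; ring
  have hle : S ≤ A * R ^ 2 * √S := by
    have h1 := le_of_tendsto hlim.norm (Eventually.of_forall fun N => norm_cesaroAvg_le hbound N)
    rw [hsum, Complex.norm_real, Real.norm_of_nonneg hS0] at h1
    exact h1
  have h2 : √S ≤ A * R ^ 2 := by
    by_contra! hlt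
    have hpos : 0 < √S := lt_of_le_of_lt (by positivity) hlt
    nlinarith [Real.mul_self_sqrt hS0]
  calc S = √S ^ 2 := (Real.sq_sqrt hS0).symm
    _ ≤ _ := by gcongr

/-- An operator with bounded Hilbert–Schmidt sums maps balls to totally bounded sets. -/
theorem totallyBounded_image_closedBall_of_sum_norm_sq_le {C : ℝ}
    (hK : ∀ s : Finset H, Orthonormal ℂ ((↑) : s → H) → ∑ e ∈ s, ‖K e‖ ^ 2 ≤ C) (r : ℝ) :
    TotallyBounded (K '' Metric.closedBall 0 r) := by
  classical
  rcases lt_or_ge r 0 with hr | hr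
  · simp [Metric.closedBall_eq_empty.2 hr]
  refine totallyBounded_of_approx fun ε hε => ?_
  set V : Set ℝ := {x | ∃ s : Finset H, Orthonormal ℂ ((↑) : s → H) ∧ x = ∑ e ∈ s, ‖K e‖ ^ 2}
  have hV0 : V.Nonempty := ⟨0, ∅, ⟨fun i => absurd i.2 (Finset.notMem_empty _),
    fun i => absurd i.2 (Finset.notMem_empty _)⟩,
    by simp⟩
  have hVb : BddAbove V := ⟨C, by rintro x ⟨s, hs, rfl⟩; exact hK s hs⟩
  set η : ℝ := ε / (2 * (r + 1)) with hη
  have hη0 : 0 < η := by positivity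
  -- With `s` nearly optimal, a further orthonormal vector can add at most `η ^ 2`, so `K` has norm
  -- at most `η` on the orthogonal complement of the span of `s`.
  obtain ⟨_, ⟨s, hs, rfl⟩, hlt⟩ := exists_lt_of_lt_csSup hV0
    (show sSup V - η ^ 2 < sSup V by linarith [pow_pos hη0 2])
  let F : Submodule ℂ H := Submodule.span ℂ (s : Set H)
  have : FiniteDimensional ℂ F := FiniteDimensional.span_of_finite ℂ s.finite_toSet
  have horth : ∀ e ∈ Fᗮ, ‖e‖ = 1 → ‖K e‖ ≤ η := by
    intro e he h1
    have hes : ∀ x ∈ s, inner ℂ x e = 0 := fun x hx =>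
      (Submodule.mem_orthogonal F e).1 he x (Submodule.subset_span hx)
    have hnot : e ∉ s := fun hmem => by
      have := hes e hmem
      rw [inner_self_eq_zero] at this
      simp [this] at h1
    have ho : Orthonormal ℂ ((↑) : ↥(insert e s) → H) := by
      refine (orthonormal_subtype_iff_ite (s := ((insert e s : Finset H) : Set H))).2 ?_
      intro v hv w hw
      rw [Finset.mem_coe] at hv hw
      rcases Finset.mem_insert.1 hv with rfl | hv' <;> rcases Finset.mem_insert.1 hw with rfl | hw'
      · rw [if_pos rfl, inner_self_eq_norm_sq_to_K, h1]; simp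
      · rw [if_neg (by rintro rfl; exact hnot hw'), ← inner_conj_symm, hes w hw']; simp
      · rw [if_neg (by rintro rfl; exact hnot hv'), hes v hv']
      · exact orthonormal_subtype_iff_ite.1 hs v hv' w hw'
    have hle : ∑ e ∈ insert e s, ‖K e‖ ^ 2 ≤ sSup V := le_csSup hVb ⟨_, ho, rfl⟩
    rw [Finset.sum_insert hnot] at hle
    exact le_of_sq_le_sq (by linarith) hη0.le
  have horth' : ∀ z ∈ Fᗮ, ‖K z‖ ≤ η * ‖z‖ := by
    intro z hz
    rcases eq_or_ne z 0 with rfl | hz0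
    · simp
    have hzn : (0 : ℝ) < ‖z‖ := norm_pos_iff.2 hz0
    have := horth (((‖z‖⁻¹ : ℝ) : ℂ) • z) (Fᗮ.smul_mem _ hz) (by
      rw [norm_smul, Complex.norm_real, norm_inv, norm_norm, inv_mul_cancel₀ hzn.ne'])
    rw [map_smul, norm_smul, Complex.norm_real, norm_inv, norm_norm, inv_mul_le_iff₀ hzn] at this
    linarith
  refine ⟨(fun z : F => K z) '' Metric.closedBall 0 r, ?_, ?_⟩
  · exact ((isCompact_closedBall (0 : F) r).image (by fun_prop)).totallyBounded
  · rintro _ ⟨x, hx, rfl⟩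
    rw [mem_closedBall_zero_iff] at hx
    refine ⟨_, ⟨F.orthogonalProjectionOnto x, ?_, rfl⟩, ?_⟩
    · rw [mem_closedBall_zero_iff]
      exact (F.norm_orthogonalProjectionOnto_apply_le x).trans hx
    · have hmem : x - F.orthogonalProjectionOnto x ∈ Fᗮ := F.sub_starProjection_mem_orthogonal x
      have hn : ‖x - F.orthogonalProjectionOnto x‖ ≤ 2 * r := by
        refine (norm_sub_le _ _).trans ?_
        have := F.norm_orthogonalProjectionOnto_apply_le x
        rw [← Submodule.coe_norm] at *
        linarith
      rw [dist_eq_norm, ← map_sub]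
      calc _ ≤ η * (2 * r) := (horth' _ hmem).trans (by gcongr)
        _ < ε := by
          rw [hη, div_mul_eq_mul_div, div_lt_iff₀ (by positivity)]
          nlinarith

theorem IsMeanOperator.totallyBounded_image_closedBall (h : IsMeanOperator a u K)
    (ha : ∀ m, |a m| ≤ A) (hu : ∀ m, ‖u m‖ ≤ R) (r : ℝ) :
    TotallyBounded (K '' Metric.closedBall 0 r) := by
  refine totallyBounded_image_closedBall_of_sum_norm_sq_le (C := (A * R ^ 2) ^ 2) ?_ r
  intro s hs
  have := h.sum_norm_sq_le ha hu hs Finset.univ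
  rwa [Finset.sum_coe_sort s fun e => ‖K e‖ ^ 2] at this

end MeanOperator

/-! ### Geometry of the strip: covers, rounding, and density of points near the line. -/

section Strip

theorem mem_directionalStrip_iff {β b : ℝ} {w : ℤ × ℤ} :
    w ∈ directionalStrip β b ↔ |β * w.1 - w.2| ≤ b / 2 := by
  rw [directionalStrip, Set.mem_ofPred_eq, abs_le]
  constructor <;> rintro ⟨h1, h2⟩ <;> constructor <;> linarith

/-- A strip is covered by finitely many translates of any other strip in the same direction. -/
theorem exists_finite_directionalStrip_cover (β b : ℝ) {b' : ℝ} (hb' : 0 < b') :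
    ∃ F : Set (ℤ × ℤ), F.Finite ∧
      ∀ w ∈ directionalStrip β b, ∃ z ∈ F, w - z ∈ directionalStrip β b' := by
  -- This map is additive and sends the strip into a bounded interval, so a finite net of values
  -- gives the translates.
  let t : ℤ × ℤ → ℝ := fun w => β * w.1 - w.2
  have htb : TotallyBounded (t '' directionalStrip β b) := by
    refine (isCompact_Icc (a := -(b / 2)) (b := b / 2)).totallyBounded.subset ?_
    rintro _ ⟨w, hw, rfl⟩
    exact abs_le.1 (mem_directionalStrip_iff.1 hw)
  obtain ⟨F, -, hFfin, hcov⟩ := Set.exists_subset_image_finite_and.1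
    (Metric.finite_approx_of_totallyBounded htb (b' / 2) (half_pos hb'))
  refine ⟨F, hFfin, fun w hw => ?_⟩
  obtain ⟨_, ⟨z, hz, rfl⟩, hwz⟩ := Set.mem_iUnion₂.1 (hcov ⟨w, hw, rfl⟩)
  refine ⟨z, hz, mem_directionalStrip_iff.2 ?_⟩
  rw [Metric.mem_ball, Real.dist_eq] at hwz
  refine le_of_eq_of_le (congrArg abs ?_) hwz.le
  simp only [t, Prod.fst_sub, Prod.snd_sub]
  push_cast
  ring

/-- The point of the lattice line over `m` that is closest to the line of slope `β`. -/
noncomputable def nearestPoint (β : ℝ) (m : ℤ) : ℤ × ℤ := (m, round (β * m))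

/-- The signed vertical distance of `nearestPoint β m` to the line of slope `β`. -/
noncomputable def verticalDefect (β : ℝ) (m : ℤ) : ℝ := β * m - round (β * m)

/-- The tent function of height and radius `c`. -/
noncomputable def tent (c x : ℝ) : ℝ := max 0 (c - |x|)

theorem tent_nonneg (c x : ℝ) : 0 ≤ tent c x := le_max_left _ _

theorem abs_tent_le {c : ℝ} (hc : 0 ≤ c) (x : ℝ) : |tent c x| ≤ c := by
  rw [abs_of_nonneg (tent_nonneg c x)]
  exact max_le hc (by linarith [abs_nonneg x])

theorem tent_of_le {c x : ℝ} (h : c ≤ |x|) : tent c x = 0 := max_eq_left (by linarith)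

/-- This is why the cutoff is a tent and not an indicator: mean operators with translated cutoffs
then depend on the translation continuously in norm. -/
theorem abs_tent_sub_tent_le (c x y : ℝ) : |tent c x - tent c y| ≤ |x - y| := by
  refine (abs_max_sub_max_le_max _ _ _ _).trans ?_
  rw [sub_self, abs_zero, max_eq_right (abs_nonneg _), sub_sub_sub_cancel_left, abs_sub_comm x y]
  exact abs_abs_sub_abs_le _ _

theorem round_eq_of_abs_sub_lt {x : ℝ} {n : ℤ} (h : |x - n| < 1 / 2) : round x = n := by
  rw [round_eq_iff]
  rw [abs_lt] at h
  exact ⟨by linarith, by linarith⟩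

/-- Rounding is not additive, but `4 * c < 1` makes it additive wherever either weight is nonzero:
the defects involved then add up to less than `1 / 2`. Elsewhere both sides vanish. -/
theorem tent_verticalDefect_mul_shift {β c : ℝ} (hc : 4 * c < 1) {w : ℤ × ℤ}
    (hw : w ∈ directionalStrip β (2 * c)) (G : ℤ × ℤ → ℂ) (m : ℤ) :
    (tent c (verticalDefect β m) : ℂ) * G (w + nearestPoint β m) =
      (tent c (verticalDefect β (m + w.1) - (β * w.1 - w.2)) : ℂ) *
        G (nearestPoint β (m + w.1)) := by
  rw [mem_directionalStrip_iff, mul_div_cancel_left₀ c two_ne_zero] at hw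
  have hround : |verticalDefect β m| < c ∨ |verticalDefect β (m + w.1) - (β * w.1 - w.2)| < c →
      round (β * ((m + w.1 : ℤ) : ℝ)) = round (β * m) + w.2 := by
    rintro (h | h)
    · refine round_eq_of_abs_sub_lt ?_
      have h1 := abs_add_le (verticalDefect β m) (β * w.1 - w.2)
      have h2 : β * ((m + w.1 : ℤ) : ℝ) - ((round (β * m) + w.2 : ℤ) : ℝ) =
          verticalDefect β m + (β * w.1 - w.2) := by
        rw [verticalDefect]; push_cast; ring
      rw [h2]
      linarith
    · have h2 : round (β * m) = round (β * ((m + w.1 : ℤ) : ℝ)) - w.2 := by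
        refine round_eq_of_abs_sub_lt ?_
        have h3 : β * (m : ℝ) - ((round (β * ((m + w.1 : ℤ) : ℝ)) - w.2 : ℤ) : ℝ) =
            verticalDefect β (m + w.1) - (β * w.1 - w.2) := by
          rw [verticalDefect]; push_cast; ring
        rw [h3]
        linarith [abs_nonneg (β * w.1 - w.2)]
      rw [h2]; ring
  by_cases h : round (β * ((m + w.1 : ℤ) : ℝ)) = round (β * m) + w.2
  · have h1 : verticalDefect β (m + w.1) - (β * w.1 - w.2) = verticalDefect β m := by
      rw [verticalDefect, verticalDefect, h]; push_cast; ring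
    have h2 : w + nearestPoint β m = nearestPoint β (m + w.1) := by
      rw [nearestPoint, nearestPoint, h]
      ext <;> simp [add_comm]
    rw [h1, h2]
  · have h1 := not_or.1 (mt hround h)
    rw [tent_of_le (not_lt.1 h1.1), tent_of_le (not_lt.1 h1.2)]
    simp

theorem abs_verticalDefect_le (β : ℝ) (m : ℤ) (n : ℤ) : |verticalDefect β m| ≤ |β * m - n| :=
  round_le _ _

theorem nearestPoint_mem_directionalStrip {β b : ℝ} {m : ℤ} (h : |verticalDefect β m| ≤ b / 2) :
    nearestPoint β m ∈ directionalStrip β b :=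
  mem_directionalStrip_iff.2 h

/-- Small vertical defects have positive lower density. -/
theorem exists_card_verticalDefect_le (β : ℝ) {c : ℝ} (hc : 0 < c) : ∃ J : ℕ, 0 < J ∧ ∀ N : ℕ,
    N ≤ J * ((Finset.range N).filter fun m : ℕ => |verticalDefect β m| ≤ c).card + J := by
  obtain ⟨J, hJ⟩ := exists_nat_gt c⁻¹
  have hJ0 : (0 : ℝ) < J := lt_trans (inv_pos.2 hc) hJ
  have hJ0' : 0 < J := by exact_mod_cast hJ0
  refine ⟨J, hJ0', fun N => ?_⟩
  -- Pigeonhole: the circle is cut into `J` arcs shorter than `c`, one of which is visited by at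
  -- least `N / J` of the indices.
  let arc : ℕ → ℤ := fun m => ⌊J * Int.fract (β * m)⌋
  have hmaps : ∀ m ∈ Finset.range N, arc m ∈ Finset.Ico (0 : ℤ) J := by
    intro m _
    rw [Finset.mem_Ico]
    refine ⟨Int.floor_nonneg.2 (by positivity), Int.floor_lt.2 ?_⟩
    have := Int.fract_lt_one (β * m)
    push_cast
    nlinarith
  obtain ⟨y, hy, hcard⟩ := Finset.exists_le_card_fiber_of_mul_le_card_of_maps_to (n := N / J) hmaps
    ⟨0, by simpa using hJ0'⟩ (by simpa using Nat.mul_div_le N J)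
  have hNle : N ≤ J * (N / J) + J := by
    have := Nat.div_add_mod N J
    have := Nat.mod_lt N hJ0'
    omega
  refine hNle.trans (Nat.add_le_add_right (Nat.mul_le_mul_left J (hcard.trans ?_)) J)
  rcases Finset.eq_empty_or_nonempty ((Finset.range N).filter fun m => arc m = y) with h0 | hne
  · rw [h0]; simp
  -- Differences of indices in one arc have small defect. Subtracting the least one keeps them
  -- distinct and in the range.
  set m₀ := Finset.min' _ hne with hm₀
  have hm₀mem := Finset.mem_filter.1 (Finset.min'_mem _ hne)
  refine Finset.card_le_card_of_injOn (fun m => m - m₀) ?_ ?_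
  · intro m hm
    have hle : m₀ ≤ m := Finset.min'_le _ _ hm
    have hm' := Finset.mem_filter.1 hm
    simp only [Finset.coe_filter, Finset.mem_range, Set.mem_ofPred_eq]
    refine ⟨by have := Finset.mem_range.1 hm'.1; omega, ?_⟩
    refine (abs_verticalDefect_le β _ (⌊β * m⌋ - ⌊β * m₀⌋)).trans ?_
    have h1 : β * (((m - m₀ : ℕ) : ℤ) : ℝ) - ((⌊β * m⌋ - ⌊β * m₀⌋ : ℤ) : ℝ) =
        Int.fract (β * m) - Int.fract (β * m₀) := by
      rw [Int.fract, Int.fract]; push_cast [hle]; ring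
    rw [h1]
    have h2 := Int.abs_sub_lt_one_of_floor_eq_floor (hm'.2.trans hm₀mem.2.symm)
    rw [← mul_sub, abs_mul, abs_of_pos hJ0] at h2
    have h3 : 1 ≤ J * c := by
      rw [← inv_mul_cancel₀ hc.ne']; gcongr
    by_contra! h4
    nlinarith
  · intro m hm m' hm' hmm
    have hle : m₀ ≤ m := Finset.min'_le _ _ hm
    have hle' : m₀ ≤ m' := Finset.min'_le _ _ hm'
    simp only at hmm
    omega

end Strip

/-! ### Vectors with totally bounded strip orbit. -/

section Orbit

variable {H : Type*} [NormedAddCommGroup H] [InnerProductSpace ℂ H]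
  {U : ℤ × ℤ → H →ₗᵢ[ℂ] H}

theorem totallyBounded_orbit_directionalStrip (hU : ∀ w w' x, U (w + w') x = U w (U w' x))
    {β b' : ℝ} (hb' : 0 < b') {v : H}
    (h : TotallyBounded ((fun w => U w v) '' directionalStrip β b')) (b : ℝ) :
    TotallyBounded ((fun w => U w v) '' directionalStrip β b) := by
  obtain ⟨F, hF, hcov⟩ := exists_finite_directionalStrip_cover β b hb'
  refine TotallyBounded.subset (s₂ := ⋃ z ∈ F, U z '' ((fun w => U w v) '' directionalStrip β b')) ?_ ?_
  · rintro _ ⟨w, hw, rfl⟩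
    obtain ⟨z, hz, hwz⟩ := hcov w hw
    refine Set.mem_iUnion₂.2 ⟨z, hz, _, ⟨w - z, hwz, rfl⟩, ?_⟩
    simp only [← hU, add_sub_cancel]
  · exact (totallyBounded_biUnion hF).2 fun z _ => h.image (U z).isometry.uniformContinuous

variable [CompleteSpace H]

/-- The main Hilbert space construction: weighted averages of `‖⟪U^w f, g⟫‖²` along a strip are
matrix coefficients of a vector with totally bounded strip orbit. -/
theorem exists_totallyBounded_orbit (hU0 : ∀ x, U 0 x = x)
    (hU : ∀ w w' x, U (w + w') x = U w (U w' x)) {β c : ℝ} (hc0 : 0 < c) (hc : 4 * c < 1)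
    (f g : H) :
    ∃ v : H, TotallyBounded ((fun w => U w v) '' directionalStrip β (2 * c)) ∧
      (∀ y, (∀ w, inner ℂ (U w f) y = 0) → inner ℂ v y = 0) ∧
      Tendsto (cesaroAvg fun m => (tent c (verticalDefect β m) : ℂ) *
        (inner ℂ g (U (nearestPoint β m) f) * inner ℂ (U (nearestPoint β m) f) g))
        (hyperfilter ℕ) (𝓝 (inner ℂ v g)) := by
  let u : ℤ → H := fun m => U (nearestPoint β m) f
  have hu : ∀ m, ‖u m‖ ≤ ‖f‖ := fun m => ((U _).norm_map f).le
  -- The cutoff recentred at height `t`; a strip element carries `K 0` to the operator for its own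
  -- height.
  let a : ℝ → ℤ → ℝ := fun t m => tent c (verticalDefect β m - t)
  have ha : ∀ t m, |a t m| ≤ c := fun t m => abs_tent_le hc0.le _
  have hex : ∀ t, ∃ K, IsMeanOperator (a t) u K := fun t => exists_isMeanOperator (ha t) hu
  choose K hK using hex
  have hKsub : ∀ t t', ‖K t - K t'‖ ≤ |t - t'| * ‖f‖ ^ 2 := by
    intro t t'
    refine ((hK t).sub (hK t')).norm_le (fun m => ?_) hu
    refine (abs_tent_sub_tent_le _ _ _).trans (le_of_eq ?_)
    rw [sub_sub_sub_cancel_left, abs_sub_comm]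
  have hadj : ∀ w x y, inner ℂ (U w x) y = inner ℂ x (U (-w) y) := by
    intro w x y
    rw [← (U w).inner_map_map x, ← hU, add_neg_cancel, hU0]
  -- Both sides are limits of the same averages up to a shift of the index by `w.1`, which does not
  -- affect the limit.
  have hconj : ∀ w ∈ directionalStrip β (2 * c), ∀ x,
      U w (K 0 x) = K (β * w.1 - w.2) (U w x) := by
    intro w hw x
    refine ext_inner_right ℂ fun y => ?_
    rw [hadj]
    refine tendsto_nhds_unique (hK 0 x (U (-w) y)) ?_
    have h1 := hK (β * w.1 - w.2) (U w x) y
    have h2 := (tendsto_cesaroAvg_shift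
      (norm_weighted_inner_mul_inner_le (ha (β * w.1 - w.2)) hu (U w x) y) w.1).mono_left
        Nat.hyperfilter_le_atTop
    have h3 := h1.add h2
    rw [add_zero] at h3
    refine h3.congr fun N => ?_
    rw [add_sub_cancel]
    congr 1
    funext m
    have h4 := tent_verticalDefect_mul_shift hc hw
      (fun z => inner ℂ (U w x) (U z f) * inner ℂ (U z f) y) m
    simp only [a, u, sub_zero]
    rw [← h4, hU, LinearIsometry.inner_map_map, hadj]
  refine ⟨K 0 g, ?_, ?_, ?_⟩
  -- The orbit lies in the images of one ball under the `K t` with `|t| ≤ c`. By `hKsub`, finitely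
  -- many `t` approximate them all.
  · refine totallyBounded_of_approx fun ε hε => ?_
    set η : ℝ := ε / (‖f‖ ^ 2 * ‖g‖ + 1) with hη
    have hη0 : 0 < η := by positivity
    obtain ⟨T, -, hTfin, hcov⟩ := Metric.finite_approx_of_totallyBounded
      (isCompact_Icc (a := -c) (b := c)).totallyBounded η hη0
    refine ⟨⋃ t ∈ T, K t '' Metric.closedBall 0 ‖g‖, (totallyBounded_biUnion hTfin).2 fun t _ =>
      (hK t).totallyBounded_image_closedBall (ha t) hu _, ?_⟩
    rintro _ ⟨w, hw, rfl⟩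
    have hmem : β * w.1 - w.2 ∈ Set.Icc (-c) c := by
      rw [mem_directionalStrip_iff, mul_div_cancel_left₀ c two_ne_zero] at hw
      exact abs_le.1 hw
    obtain ⟨t, ht, hwt⟩ := Set.mem_iUnion₂.1 (hcov hmem)
    rw [Metric.mem_ball, Real.dist_eq] at hwt
    refine ⟨K t (U w g), Set.mem_iUnion₂.2 ⟨t, ht, _, by simp, rfl⟩, ?_⟩
    simp only [hconj w hw]
    rw [dist_eq_norm, ← sub_apply]
    calc _ ≤ ‖K (β * w.1 - w.2) - K t‖ * ‖U w g‖ := ContinuousLinearMap.le_opNorm _ _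
      _ ≤ (η * ‖f‖ ^ 2) * ‖g‖ := by
          rw [LinearIsometry.norm_map]
          gcongr
          exact (hKsub _ _).trans (by gcongr)
      _ < ε := by
          rw [hη, div_mul_eq_mul_div, div_mul_eq_mul_div, div_lt_iff₀ (by positivity)]
          nlinarith
  · intro y hy
    refine tendsto_nhds_unique (hK 0 g y) (Tendsto.congr (f₁ := fun _ => 0) (fun N => ?_)
      tendsto_const_nhds)
    simp [cesaroAvg, u, hy]
  · simpa [a] using hK 0 g g

end Orbit

/-! ### The Koopman operators and their compatibility with Lipschitz maps. -/

section KoopmanBasic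

variable {X : Type*} [MeasurableSpace X] [AddAction (ℤ × ℤ) X] [MeasurableConstVAdd (ℤ × ℤ) X]
  (μ : Measure X) [VAddInvariantMeasure (ℤ × ℤ) X μ]

theorem koopman_coeFn (w : ℤ × ℤ) (f : Lp ℂ 2 μ) :
    koopman μ w f =ᵐ[μ] fun x => f (w +ᵥ x) :=
  Lp.coeFn_compMeasurePreserving f (measurePreserving_vadd w μ)

theorem koopman_zero (f : Lp ℂ 2 μ) : koopman μ 0 f = f := by
  refine Lp.ext ((koopman_coeFn μ 0 f).trans ?_)
  simp

theorem koopman_add (w w' : ℤ × ℤ) (f : Lp ℂ 2 μ) :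
    koopman μ (w + w') f = koopman μ w (koopman μ w' f) := by
  refine Lp.ext ((koopman_coeFn μ _ f).trans ?_)
  refine EventuallyEq.trans ?_ (koopman_coeFn μ w _).symm
  have h := (measurePreserving_vadd w μ).quasiMeasurePreserving.ae_eq_comp (koopman_coeFn μ w' f)
  refine EventuallyEq.trans ?_ h.symm
  refine Eventually.of_forall fun x => ?_
  simp only [Function.comp_apply]
  rw [add_comm, add_vadd]

theorem koopman_indicatorConstLp (w : ℤ × ℤ) {B : Set X} (hB : MeasurableSet B) (hμB : μ B ≠ ⊤) :
    koopman μ w (indicatorConstLp 2 hB hμB (1 : ℂ)) =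
      indicatorConstLp 2 (hB.preimage (measurable_const_vadd w))
        (by rwa [(measurePreserving_vadd w μ).measure_preimage hB.nullMeasurableSet]) (1 : ℂ) :=
  Lp.indicatorConstLp_compMeasurePreserving hB hμB 1 (measurePreserving_vadd w μ)

variable {μ}

theorem koopman_compLp {ψ : ℂ → ℂ} {C : NNReal} (hψ : LipschitzWith C ψ) (h0 : ψ 0 = 0)
    (w : ℤ × ℤ) (f : Lp ℂ 2 μ) : koopman μ w (hψ.compLp h0 f) = hψ.compLp h0 (koopman μ w f) := by
  refine Lp.ext ((koopman_coeFn μ w _).trans ?_)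
  refine EventuallyEq.trans ?_ (hψ.coeFn_compLp h0 _).symm
  have h := (measurePreserving_vadd w μ).quasiMeasurePreserving.ae_eq_comp (hψ.coeFn_compLp h0 f)
  filter_upwards [h, koopman_coeFn μ w f] with x hx hx'
  simp only [Function.comp_apply] at hx ⊢
  rw [hx, hx']

theorem totallyBounded_koopman_compLp {ψ : ℂ → ℂ} {C : NNReal} (hψ : LipschitzWith C ψ)
    (h0 : ψ 0 = 0) {f : Lp ℂ 2 μ} {S : Set (ℤ × ℤ)}
    (h : TotallyBounded ((fun w => koopman μ w f) '' S)) :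
    TotallyBounded ((fun w => koopman μ w (hψ.compLp h0 f)) '' S) := by
  have := h.image (hψ.lipschitzWith_compLp h0 (p := 2) (μ := μ)).uniformContinuous
  simpa only [Set.image_image, koopman_compLp] using this

theorem totallyBounded_koopman_smul (c : ℂ) {f : Lp ℂ 2 μ} {S : Set (ℤ × ℤ)}
    (h : TotallyBounded ((fun w => koopman μ w f) '' S)) :
    TotallyBounded ((fun w => koopman μ w (c • f)) '' S) := by
  have := h.image (uniformContinuous_const_smul c)
  simpa only [Set.image_image, map_smul] using this

end KoopmanBasic

/-! ### From trivial Kronecker algebra to vanishing correlations. -/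

section Kronecker

variable {X : Type*} [MeasurableSpace X] [AddAction (ℤ × ℤ) X] [MeasurableConstVAdd (ℤ × ℤ) X]
  {μ : Measure X} [VAddInvariantMeasure (ℤ × ℤ) X μ] [IsProbabilityMeasure μ] {β b : ℝ}

theorem mem_directionalKronecker_iff {B : Set X} :
    B ∈ directionalKronecker μ β b ↔ ∃ hB : MeasurableSet B, TotallyBounded
      ((fun w => koopman μ w (indicatorConstLp 2 hB (measure_ne_top μ B) (1 : ℂ))) ''
        directionalStrip β b) :=
  exists_congr fun _ => ⟨fun h => h.totallyBounded.subset subset_closure,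
    fun h => isCompact_iff_totallyBounded_isComplete.2 ⟨h.closure, isClosed_closure.isComplete⟩⟩

/-- The function that truncates `n * re z` to `[0, 1]`. -/
noncomputable def clampRe (n : ℕ) (z : ℂ) : ℂ := ((max 0 (min 1 (n * z.re)) : ℝ) : ℂ)

theorem lipschitzWith_clampRe (n : ℕ) : LipschitzWith n (clampRe n) := by
  refine LipschitzWith.of_dist_le_mul fun z z' => ?_
  rw [dist_eq_norm, clampRe, clampRe, ← Complex.ofReal_sub, Complex.norm_real, Real.norm_eq_abs]
  refine (abs_max_sub_max_le_max _ _ _ _).trans ?_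
  rw [sub_self, abs_zero, max_eq_right (abs_nonneg _)]
  refine (abs_min_sub_min_le_max _ _ _ _).trans ?_
  rw [sub_self, abs_zero, max_eq_right (abs_nonneg _), ← mul_sub, abs_mul, Nat.abs_cast,
    dist_eq_norm, ← Complex.sub_re]
  simp only [NNReal.coe_natCast]
  gcongr
  exact Complex.abs_re_le_norm _

theorem clampRe_zero (n : ℕ) : clampRe n 0 = 0 := by simp [clampRe]

theorem norm_clampRe_sub_indicator_le (n : ℕ) (z : ℂ) :
    ‖clampRe n z - Set.indicator {z : ℂ | 0 < z.re} (fun _ => (1 : ℂ)) z‖ ≤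
      ‖Set.indicator {z : ℂ | 0 < z.re ∧ n * z.re < 1} (fun _ => (1 : ℂ)) z‖ := by
  have hn : (0 : ℝ) ≤ n := n.cast_nonneg
  by_cases h : 0 < z.re
  · by_cases h1 : n * z.re < 1
    · have h2 : 0 ≤ n * z.re := by positivity
      simp only [clampRe, Set.indicator, Set.mem_ofPred_eq, h, h1, and_self, if_true, norm_one]
      rw [← Complex.ofReal_one, ← Complex.ofReal_sub, Complex.norm_real, Real.norm_eq_abs,
        min_eq_right h1.le, max_eq_right h2, abs_le]
      constructor <;> linarith
    · simp [clampRe, Set.indicator, h, h1, min_eq_left (not_lt.1 h1)]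
  · have h2 : n * z.re ≤ 0 := mul_nonpos_of_nonneg_of_nonpos hn (not_lt.1 h)
    have h3 : min 1 (n * z.re) ≤ 0 := (min_le_right _ _).trans h2
    simp [clampRe, Set.indicator, h, max_eq_left h3]

/-- The indicator is an `L²` limit of the Lipschitz functions `clampRe n` of `f`, which inherit
totally bounded orbits. The error lives on the sets `D n`, which decrease to the empty set. -/
theorem setOf_re_pos_mem_directionalKronecker {f : Lp ℂ 2 μ}
    (h : TotallyBounded ((fun w => koopman μ w f) '' directionalStrip β b)) :
    {x | 0 < (f x).re} ∈ directionalKronecker μ β b := by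
  have hre : Measurable fun x => (f x).re :=
    Complex.measurable_re.comp (Lp.stronglyMeasurable f).measurable
  have hB : MeasurableSet {x | 0 < (f x).re} := measurableSet_lt measurable_const hre
  refine mem_directionalKronecker_iff.2 ⟨hB, totallyBounded_of_approx fun ε hε => ?_⟩
  let D : ℕ → Set X := fun n => {x | 0 < (f x).re ∧ n * (f x).re < 1}
  have hD : ∀ n, MeasurableSet (D n) := fun n =>
    hB.inter (measurableSet_lt (hre.const_mul _) measurable_const)
  have hDlim : Tendsto (fun n => μ (D n)) atTop (𝓝 0) := by
    have hanti : Antitone D := fun n m hnm x hx => ⟨hx.1, lt_of_le_of_lt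
      (mul_le_mul_of_nonneg_right (by exact_mod_cast hnm) hx.1.le) hx.2⟩
    have hempty : ⋂ n, D n = ∅ := by
      refine Set.eq_empty_iff_forall_notMem.2 fun x hx => ?_
      rw [Set.mem_iInter] at hx
      obtain ⟨n, hn⟩ := exists_nat_gt ((f x).re)⁻¹
      have h1 := (hx n).2
      have h2 := (hx n).1
      have h3 := mul_lt_mul_of_pos_right hn h2
      rw [inv_mul_cancel₀ h2.ne'] at h3
      linarith
    have := tendsto_measure_iInter_atTop (fun n => (hD n).nullMeasurableSet) hanti
      ⟨0, measure_ne_top μ _⟩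
    rwa [hempty, measure_empty] at this
  have hDlim' : Tendsto (fun n => ‖indicatorConstLp 2 (hD n) (measure_ne_top μ _) (1 : ℂ)‖)
      atTop (𝓝 0) := by
    have h1 : Tendsto (fun n => μ.real (D n)) atTop (𝓝 0) :=
      (ENNReal.tendsto_toReal ENNReal.zero_ne_top).comp hDlim
    have h2 := h1.rpow_const (p := 1 / (2 : ENNReal).toReal) (Or.inr (by simp))
    simp only [norm_indicatorConstLp two_ne_zero ENNReal.ofNat_ne_top, norm_one, one_mul]
    simpa using h2
  obtain ⟨n, hn⟩ := (hDlim'.eventually (gt_mem_nhds hε)).exists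
  refine ⟨_, totallyBounded_koopman_compLp (lipschitzWith_clampRe n) (clampRe_zero n) h, ?_⟩
  rintro _ ⟨w, hw, rfl⟩
  refine ⟨_, ⟨w, hw, rfl⟩, ?_⟩
  simp only [LinearIsometry.dist_map]
  rw [dist_comm, dist_eq_norm]
  refine lt_of_le_of_lt (Lp.norm_le_norm_of_ae_le ?_) hn
  filter_upwards [Lp.coeFn_sub ((lipschitzWith_clampRe n).compLp (clampRe_zero n) f)
    (indicatorConstLp 2 hB (measure_ne_top μ _) (1 : ℂ)),
    (lipschitzWith_clampRe n).coeFn_compLp (clampRe_zero n) f,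
    indicatorConstLp_coeFn (p := 2) (hs := hB) (hμs := measure_ne_top μ _) (c := (1 : ℂ)),
    indicatorConstLp_coeFn (p := 2) (hs := hD n) (hμs := measure_ne_top μ _) (c := (1 : ℂ))]
    with x h1 h2 h3 h4
  rw [h1, Pi.sub_apply, h2, h3, h4]
  exact norm_clampRe_sub_indicator_le n (f x)

/-- For each `c`, the set where `c * f` has positive real part is null or conull, and a zero
integral excludes the conull case. The four values `1, -1, I, -I` of `c` then leave only `f = 0`. -/
theorem IsDirectionalWeakMixing.eq_zero (hwm : IsDirectionalWeakMixing μ β b) {f : Lp ℂ 2 μ}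
    (h : TotallyBounded ((fun w => koopman μ w f) '' directionalStrip β b))
    (hint : ∫ x, f x ∂μ = 0) : f = 0 := by
  have hfi : Integrable f μ := (Lp.memLp f).integrable one_le_two
  have key : ∀ c : ℂ, ∀ᵐ x ∂μ, (c * f x).re ≤ 0 := by
    intro c
    have hcoe := Lp.coeFn_smul c f
    have hmul : Integrable (fun x => c * f x) μ := hfi.const_mul c
    rcases hwm _ (setOf_re_pos_mem_directionalKronecker (totallyBounded_koopman_smul c h))
      with h0 | h0
    · have h0' : ∀ᵐ x ∂μ, ¬ 0 < ((c • f : Lp ℂ 2 μ) x).re := measure_eq_zero_iff_ae_notMem.1 h0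
      filter_upwards [h0', hcoe] with x hx hx'
      rw [hx'] at hx
      simpa using hx
    · have h0' : ∀ᵐ x ∂μ, 0 < ((c • f : Lp ℂ 2 μ) x).re := h0
      have h1 : 0 ≤ᵐ[μ] fun x => (c * f x).re := by
        filter_upwards [h0', hcoe] with x hx hx'
        rw [hx'] at hx
        exact hx.le
      have h2 : ∫ x, (c * f x).re ∂μ = 0 := by
        have := integral_re hmul
        rw [integral_const_mul, hint, mul_zero] at this
        simpa using this
      have h3 := (integral_eq_zero_iff_of_nonneg_ae h1 hmul.re).1 h2
      filter_upwards [h3] with x hx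
      exact hx.le
  refine (Lp.eq_zero_iff_ae_eq_zero).2 ?_
  filter_upwards [key 1, key (-1), key Complex.I, key (-Complex.I)] with x h1 h2 h3 h4
  simp at h1 h2 h3 h4
  exact Complex.ext (le_antisymm h1 h2) (le_antisymm h4 h3)

theorem IsDirectionalWeakMixing.tendsto_cesaroAvg {b₀ : ℝ}
    (hwm : IsDirectionalWeakMixing μ β b₀) {c : ℝ} (hc0 : 0 < c) (hc : 4 * c < 1)
    {f : Lp ℂ 2 μ} (hf : ∫ x, f x ∂μ = 0) (g : Lp ℂ 2 μ) :
    Tendsto (cesaroAvg fun m => (tent c (verticalDefect β m) : ℂ) *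
      (inner ℂ g (koopman μ (nearestPoint β m) f) * inner ℂ (koopman μ (nearestPoint β m) f) g))
      (hyperfilter ℕ) (𝓝 0) := by
  obtain ⟨v, hv, horth, hlim⟩ := exists_totallyBounded_orbit (koopman_zero μ) (koopman_add μ)
    (β := β) hc0 hc f g
  have hone : ∀ z : Lp ℂ 2 μ,
      inner ℂ (indicatorConstLp 2 MeasurableSet.univ (measure_ne_top μ _) (1 : ℂ)) z =
        ∫ x, z x ∂μ := fun z => by
    rw [L2.inner_indicatorConstLp_one, setIntegral_univ]
  have hv0 : v = 0 := by
    refine hwm.eq_zero (totallyBounded_orbit_directionalStrip (koopman_add μ)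
      (by positivity : 0 < 2 * c) hv b₀) ?_
    rw [← hone, ← inner_conj_symm, horth, map_zero]
    intro w
    rw [← inner_conj_symm, hone, integral_congr_ae (koopman_coeFn μ w f),
      (measurePreserving_vadd w μ).integral_comp (measurableEmbedding_const_vadd w) f, hf,
      map_zero]
  rwa [hv0, inner_zero_left] at hlim

/-- Under directional weak mixing, finitely many correlations with mean zero functions are
simultaneously small at points of the strip arbitrarily far to the right. -/
theorem IsDirectionalWeakMixing.exists_inner_lt {b₀ : ℝ}
    (hwm : IsDirectionalWeakMixing μ β b₀) (hb : 0 < b) {ι κ : Type*} [Fintype ι] [Fintype κ]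
    (f : ι → Lp ℂ 2 μ) (hf : ∀ i, ∫ x, f i x ∂μ = 0) (g : κ → Lp ℂ 2 μ) {ε : ℝ} (hε : 0 < ε)
    (N₀ : ℤ) : ∃ w ∈ directionalStrip β b, N₀ < w.1 ∧
      ∀ i j, ‖inner ℂ (g j) (koopman μ w (f i))‖ < ε := by
  by_contra! hcon
  -- The bound `b / 2` keeps the sampled points in the strip, and `1 / 8` ensures `4 * c < 1`.
  set c : ℝ := min (b / 2) (1 / 8) with hcdef
  have hc0 : 0 < c := lt_min (half_pos hb) (by norm_num)
  have hc : 4 * c < 1 := by linarith [min_le_right (b / 2) (1 / 8 : ℝ)]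
  have hcb : c ≤ b / 2 := min_le_left _ _
  let Q : ℤ → ℝ := fun m => ∑ i, ∑ j, ‖inner ℂ (g j) (koopman μ (nearestPoint β m) (f i))‖ ^ 2
  have hQ0 : ∀ m, 0 ≤ Q m := fun m => by positivity
  have hQ : ∀ m, N₀ < m → |verticalDefect β m| ≤ c / 2 → ε ^ 2 ≤ Q m := by
    intro m hm hδ
    obtain ⟨i, j, hij⟩ := hcon (nearestPoint β m)
      (nearestPoint_mem_directionalStrip (by linarith)) hm
    calc ε ^ 2 ≤ ‖inner ℂ (g j) (koopman μ (nearestPoint β m) (f i))‖ ^ 2 := by gcongr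
      _ ≤ ∑ j, ‖inner ℂ (g j) (koopman μ (nearestPoint β m) (f i))‖ ^ 2 :=
        Finset.single_le_sum (f := fun j => ‖inner ℂ (g j) (koopman μ (nearestPoint β m) (f i))‖ ^ 2)
          (fun _ _ => by positivity) (Finset.mem_univ j)
      _ ≤ Q m := Finset.single_le_sum (f := fun i =>
          ∑ j, ‖inner ℂ (g j) (koopman μ (nearestPoint β m) (f i))‖ ^ 2)
          (fun _ _ => by positivity) (Finset.mem_univ i)
  have hlim : Tendsto (cesaroAvg fun m => ((tent c (verticalDefect β m) * Q m : ℝ) : ℂ))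
      (hyperfilter ℕ) (𝓝 0) := by
    have h1 := tendsto_finsetSum Finset.univ fun i (_ : i ∈ Finset.univ) =>
      tendsto_finsetSum Finset.univ fun j (_ : j ∈ Finset.univ) =>
        hwm.tendsto_cesaroAvg hc0 hc (hf i) (g j)
    simp only [Finset.sum_const_zero] at h1
    refine h1.congr fun N => ?_
    simp only [← cesaroAvg_sum]
    congr 1
    funext m
    simp only [Q]
    push_cast
    simp only [Finset.mul_sum]
    refine Finset.sum_congr rfl fun i _ => Finset.sum_congr rfl fun j _ => ?_
    rw [← inner_conj_symm (koopman μ (nearestPoint β m) (f i)) (g j), RCLike.mul_conj]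
    rfl
  obtain ⟨J, hJ, hcard⟩ := exists_card_verticalDefect_le β (half_pos hc0)
  have hJ' : (0 : ℝ) < J := by exact_mod_cast hJ
  set M : ℕ := (N₀ + 1).toNat with hM
  -- Where the defect is at most `c / 2` the tent is at least `c / 2`. Such indices have density at
  -- least `1 / J`, and dropping those below `M` costs only `M / N`.
  have hlow : ∀ N : ℕ, 0 < N → c / 2 * ε ^ 2 * ((J : ℝ)⁻¹ - (1 + M) * (N : ℝ)⁻¹) ≤
      ‖cesaroAvg (fun m => ((tent c (verticalDefect β m) * Q m : ℝ) : ℂ)) N‖ := by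
    intro N hN
    have hN' : (0 : ℝ) < N := by exact_mod_cast hN
    have hterm : ∀ m : ℕ, 0 ≤ tent c (verticalDefect β m) * Q m := fun m =>
      mul_nonneg (tent_nonneg _ _) (hQ0 _)
    rw [cesaroAvg, norm_mul, norm_inv, Complex.norm_natCast, ← Complex.ofReal_sum,
      Complex.norm_real, Real.norm_of_nonneg (Finset.sum_nonneg fun m _ => hterm m),
      le_inv_mul_iff₀ hN']
    set G := (Finset.range N).filter fun m : ℕ => |verticalDefect β m| ≤ c / 2 with hG
    have hsum : ((G.card : ℝ) - M) * (c / 2 * ε ^ 2) ≤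
        ∑ m ∈ Finset.range N, tent c (verticalDefect β m) * Q m := by
      have h1 : ((G \ Finset.range M).card : ℝ) * (c / 2 * ε ^ 2) ≤
          ∑ m ∈ G \ Finset.range M, tent c (verticalDefect β m) * Q m := by
        rw [← nsmul_eq_mul]
        refine Finset.card_nsmul_le_sum _ _ _ fun m hm => ?_
        rw [Finset.mem_sdiff, Finset.mem_filter, Finset.mem_range] at hm
        have hm2 : M ≤ m := by simpa using hm.2
        refine mul_le_mul ?_ (hQ m (by omega) hm.1.2) (by positivity) (tent_nonneg _ _)
        exact le_max_of_le_right (by linarith [hm.1.2])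
      have h2 : (G.card : ℝ) - M ≤ (G \ Finset.range M).card := by
        have := Finset.le_card_sdiff (Finset.range M) G
        rw [Finset.card_range] at this
        have h3 : G.card ≤ (G \ Finset.range M).card + M := by omega
        have h4 : (G.card : ℝ) ≤ (G \ Finset.range M).card + M := by exact_mod_cast h3
        linarith
      refine (mul_le_mul_of_nonneg_right h2 (by positivity)).trans (h1.trans ?_)
      exact Finset.sum_le_sum_of_subset_of_nonneg
        (Finset.sdiff_subset.trans (Finset.filter_subset _ _)) fun m _ _ => hterm m
    refine le_trans ?_ hsum
    have h5 : (N : ℝ) ≤ J * G.card + J := by exact_mod_cast hcard N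
    have h6 : (N : ℝ) * (J : ℝ)⁻¹ ≤ G.card + 1 := by
      rw [← div_eq_mul_inv, div_le_iff₀ hJ']; linarith
    calc (N : ℝ) * (c / 2 * ε ^ 2 * ((J : ℝ)⁻¹ - (1 + M) * (N : ℝ)⁻¹))
        = ((N : ℝ) * (J : ℝ)⁻¹ - (1 + M)) * (c / 2 * ε ^ 2) := by field_simp
      _ ≤ _ := mul_le_mul_of_nonneg_right (by linarith) (by positivity)
  have hlim2 : Tendsto (fun N : ℕ => c / 2 * ε ^ 2 * ((J : ℝ)⁻¹ - (1 + M) * (N : ℝ)⁻¹))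
      (hyperfilter ℕ) (𝓝 (c / 2 * ε ^ 2 * ((J : ℝ)⁻¹ - (1 + M) * 0))) :=
    ((((tendsto_inv_atTop_nhds_zero_nat (𝕜 := ℝ)).const_mul _).const_sub _).const_mul
      _).mono_left Nat.hyperfilter_le_atTop
  have hle := le_of_tendsto_of_tendsto hlim2 hlim.norm
    ((eventually_gt_atTop 0).filter_mono Nat.hyperfilter_le_atTop |>.mono hlow)
  rw [norm_zero, mul_zero, sub_zero] at hle
  have : 0 < c / 2 * ε ^ 2 * (J : ℝ)⁻¹ := by positivity
  linarith

/-- Under directional weak mixing, there are points of the strip arbitrarily far to the right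
at which finitely many given pairs of sets are almost independent. -/
theorem IsDirectionalWeakMixing.exists_measureReal_inter_lt {b₀ : ℝ}
    (hwm : IsDirectionalWeakMixing μ β b₀) (hb : 0 < b) {ι κ : Type*} [Fintype ι] [Fintype κ]
    {A : ι → Set X} (hA : ∀ i, MeasurableSet (A i)) {C : κ → Set X}
    (hC : ∀ j, MeasurableSet (C j)) {ε : ℝ} (hε : 0 < ε) (N₀ : ℤ) :
    ∃ w ∈ directionalStrip β b, N₀ < w.1 ∧ ∀ i j,
      |μ.real (C j ∩ (fun x => w +ᵥ x) ⁻¹' A i) - μ.real (C j) * μ.real (A i)| < ε := by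
  let I : ∀ B : Set X, MeasurableSet B → Lp ℂ 2 μ := fun B hB =>
    indicatorConstLp 2 hB (measure_ne_top μ B) (1 : ℂ)
  have hI : ∀ (B D : Set X) (hB : MeasurableSet B) (hD : MeasurableSet D),
      inner ℂ (I B hB) (I D hD) = (μ.real (B ∩ D) : ℂ) := by
    intro B D hB hD
    rw [L2.inner_indicatorConstLp_one, setIntegral_indicatorConstLp hB]
    simp [Set.inter_comm]
  obtain ⟨w, hw, hN, hlt⟩ := hwm.exists_inner_lt hb
    (fun i => I (A i) (hA i) - (μ.real (A i) : ℂ) • I Set.univ MeasurableSet.univ) (fun i => by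
      rw [← setIntegral_univ, ← L2.inner_indicatorConstLp_one MeasurableSet.univ
        (measure_ne_top μ _), inner_sub_right, inner_smul_right, hI, hI]
      simp) (fun j => I (C j) (hC j)) hε N₀
  refine ⟨w, hw, hN, fun i j => ?_⟩
  have h1 := hlt i j
  rw [map_sub, map_smul, koopman_indicatorConstLp, koopman_indicatorConstLp, inner_sub_right,
    inner_smul_right, hI, hI, Set.preimage_univ, Set.inter_univ, ← Complex.ofReal_mul,
    ← Complex.ofReal_sub, Complex.norm_real, Real.norm_eq_abs, mul_comm (μ.real (A i))] at h1
  exact h1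

end Kronecker

/-! ### Entropy of finite-valued functions; joins become tuples of labels. -/

section Entropy

variable {X : Type*} [MeasurableSpace X] (μ : Measure X)

/-- The Shannon entropy of the distribution of a finite-valued function. -/
noncomputable def valueEntropy {ι : Type*} [Fintype ι] (g : X → ι) : ℝ :=
  ∑ i, Real.negMulLog (μ.real (g ⁻¹' {i}))

theorem partitionEntropy_eq_valueEntropy {ι : Type*} [Fintype ι] {A : ι → Set X} {g : X → ι}
    (h : ∀ i, A i = g ⁻¹' {i}) : partitionEntropy μ A = valueEntropy μ g := by
  simp [partitionEntropy, valueEntropy, Real.negMulLog, h]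

theorem IsMeasurablePartition.exists_label {ι : Type*} [Fintype ι] [MeasurableSpace ι]
    [MeasurableSingletonClass ι] {A : ι → Set X} (hA : IsMeasurablePartition A) :
    ∃ g : X → ι, Measurable g ∧ ∀ i, A i = g ⁻¹' {i} := by
  have hex : ∀ x, ∃ i, x ∈ A i := fun x => Set.mem_iUnion.1 (hA.iUnion_eq_univ ▸ Set.mem_univ x)
  choose g hg using hex
  have hAg : ∀ i, A i = g ⁻¹' {i} := by
    intro i
    ext x
    rw [Set.mem_preimage, Set.mem_singleton_iff]
    refine ⟨fun hx => ?_, fun hx => hx ▸ hg x⟩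
    by_contra hne
    exact Set.disjoint_left.1 (hA.pairwise_disjoint hne) (hg x) hx
  exact ⟨g, measurable_to_countable' fun i => hAg i ▸ hA.measurableSet i, hAg⟩

theorem isMeasurablePartition_compl {B : Set X} (hB : MeasurableSet B) :
    IsMeasurablePartition ![B, Bᶜ] where
  measurableSet i := by fin_cases i <;> simp [hB]
  pairwise_disjoint i j hij := by
    fin_cases i <;> fin_cases j <;> simp_all [disjoint_compl_right, disjoint_compl_left]
  iUnion_eq_univ := by
    ext x
    simp [Fin.exists_fin_two, em]

variable {μ} [IsProbabilityMeasure μ] {ι κ : Type*} [Fintype ι] [Fintype κ]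

theorem valueEntropy_nonneg (g : X → ι) : 0 ≤ valueEntropy μ g :=
  Finset.sum_nonneg fun _ _ => Real.negMulLog_nonneg measureReal_nonneg measureReal_le_one

theorem valueEntropy_pos {g : X → ι} {i : ι} (h0 : 0 < μ.real (g ⁻¹' {i}))
    (h1 : μ.real (g ⁻¹' {i}) < 1) : 0 < valueEntropy μ g := by
  refine Finset.sum_pos' (fun _ _ => Real.negMulLog_nonneg measureReal_nonneg measureReal_le_one)
    ⟨i, Finset.mem_univ i, ?_⟩
  rw [Real.negMulLog_eq_neg]
  exact neg_pos.2 (mul_neg_of_pos_of_neg h0 (Real.log_neg h0 h1))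

variable [MeasurableSpace ι] [MeasurableSingletonClass ι]

theorem sum_measureReal_fiber {g : X → ι} (hg : Measurable g) :
    ∑ i, μ.real (g ⁻¹' {i}) = 1 := by
  rw [sum_measureReal_preimage_singleton _ fun i _ => hg (measurableSet_singleton i)]
  simp

theorem sum_measureReal_inter_fiber {g : X → ι} (hg : Measurable g) (B : Set X) :
    ∑ i, μ.real (B ∩ g ⁻¹' {i}) = μ.real B := by
  have h := sum_measureReal_preimage_singleton (μ := μ.restrict B) (f := g) Finset.univ
    fun i _ => hg (measurableSet_singleton i)
  simp only [measureReal_restrict_apply (hg (measurableSet_singleton _)), Finset.coe_univ,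
    Set.preimage_univ, measureReal_restrict_apply_univ] at h
  simpa only [Set.inter_comm B] using h

theorem negMulLog_sum_le {α : Type*} (s : Finset α) {p : α → ℝ} (hp : ∀ i, 0 ≤ p i) :
    Real.negMulLog (∑ i ∈ s, p i) ≤ ∑ i ∈ s, Real.negMulLog (p i) := by
  simp only [Real.negMulLog_eq_neg, Finset.sum_neg_distrib, neg_le_neg_iff]
  rw [Finset.sum_mul]
  refine Finset.sum_le_sum fun i hi => ?_
  rcases (hp i).eq_or_lt with h0 | h0
  · simp [← h0]
  · exact mul_le_mul_of_nonneg_left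
      (Real.log_le_log h0 (Finset.single_le_sum (fun j _ => hp j) hi)) (hp i)

theorem valueEntropy_comp_le {g : X → ι} (hg : Measurable g) (φ : ι → κ) :
    valueEntropy μ (fun x => φ (g x)) ≤ valueEntropy μ g := by
  classical
  have hfib : ∀ k, μ.real ((fun x => φ (g x)) ⁻¹' {k}) =
      ∑ i ∈ Finset.univ.filter (fun i => φ i = k), μ.real (g ⁻¹' {i}) := by
    intro k
    rw [sum_measureReal_preimage_singleton _ fun i _ => hg (measurableSet_singleton i)]
    congr 1
    ext x
    simp
  rw [valueEntropy, valueEntropy, ← Finset.sum_fiberwise Finset.univ φ]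
  refine Finset.sum_le_sum fun k _ => ?_
  rw [hfib]
  exact negMulLog_sum_le _ fun i => measureReal_nonneg

/-- This is `log x ≤ x - 1` at `x = a * b / p`. With `p` a joint probability and `a, b` its
marginals, the corrections `a * b - p` sum to zero, which gives subadditivity of entropy. -/
theorem negMulLog_le_of_le {p a b : ℝ} (hp : 0 ≤ p) (ha : p ≤ a) (hb : p ≤ b) :
    Real.negMulLog p ≤ -(p * Real.log a) - p * Real.log b + (a * b - p) := by
  rcases hp.eq_or_lt with rfl | h0
  · simpa using mul_nonneg ha hb
  · have ha0 := h0.trans_le ha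
    have hb0 := h0.trans_le hb
    have h1 := Real.log_le_sub_one_of_pos (show 0 < a * b / p by positivity)
    rw [Real.log_div (by positivity) h0.ne', Real.log_mul ha0.ne' hb0.ne'] at h1
    have h2 := mul_le_mul_of_nonneg_left h1 hp
    have h3 : p * (a * b / p - 1) = a * b - p := by field_simp
    rw [h3] at h2
    rw [Real.negMulLog_eq_neg]
    dsimp only
    nlinarith

variable [MeasurableSpace κ] [MeasurableSingletonClass κ]

theorem valueEntropy_prod_le {g : X → ι} (hg : Measurable g) {g' : X → κ} (hg' : Measurable g') :
    valueEntropy μ (fun x => (g x, g' x)) ≤ valueEntropy μ g + valueEntropy μ g' := by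
  let P : ι → κ → ℝ := fun i k => μ.real (g ⁻¹' {i} ∩ g' ⁻¹' {k})
  have hP : ∀ z : ι × κ, μ.real ((fun x => (g x, g' x)) ⁻¹' {z}) = P z.1 z.2 := by
    intro z
    simp only [P]
    congr 1
    ext x
    simp [Prod.ext_iff]
  have hP1 : ∀ i, ∑ k, P i k = μ.real (g ⁻¹' {i}) := fun i => sum_measureReal_inter_fiber hg' _
  have hP2 : ∀ k, ∑ i, P i k = μ.real (g' ⁻¹' {k}) := fun k => by
    simp only [P, Set.inter_comm (g ⁻¹' _)]
    exact sum_measureReal_inter_fiber hg _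
  calc valueEntropy μ (fun x => (g x, g' x))
      = ∑ i, ∑ k, Real.negMulLog (P i k) := by
        simp only [valueEntropy, hP, Fintype.sum_prod_type]
    _ ≤ ∑ i, ∑ k, (-(P i k * Real.log (μ.real (g ⁻¹' {i}))) -
          P i k * Real.log (μ.real (g' ⁻¹' {k})) +
          (μ.real (g ⁻¹' {i}) * μ.real (g' ⁻¹' {k}) - P i k)) :=
        Finset.sum_le_sum fun i _ => Finset.sum_le_sum fun k _ =>
          negMulLog_le_of_le measureReal_nonneg (measureReal_mono Set.inter_subset_left)
            (measureReal_mono Set.inter_subset_right)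
    _ = valueEntropy μ g + valueEntropy μ g' := by
        simp only [Finset.sum_add_distrib, Finset.sum_sub_distrib, Finset.sum_neg_distrib,
          ← Finset.sum_mul, ← Finset.mul_sum, hP1, sum_measureReal_fiber hg,
          sum_measureReal_fiber hg']
        rw [Finset.sum_comm (f := fun i k => P i k * Real.log (μ.real (g' ⁻¹' {k})))]
        simp only [← Finset.sum_mul, hP2]
        simp [valueEntropy, Real.negMulLog_eq_neg]
        ring

theorem valueEntropy_pi_le {k : ℕ} {g : Fin k → X → ι} (hg : ∀ i, Measurable (g i)) :
    valueEntropy μ (fun x i => g i x) ≤ ∑ i, valueEntropy μ (g i) := by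
  induction k with
  | zero => simp [valueEntropy, Set.preimage, Subsingleton.elim _ (default : Fin 0 → ι)]
  | succ k ih =>
    have htail : Measurable fun x (i : Fin k) => g i.succ x :=
      measurable_pi_lambda _ fun i => hg i.succ
    have h1 := valueEntropy_comp_le (μ := μ) ((hg 0).prodMk htail)
      (fun z : ι × (Fin k → ι) => (Fin.cons z.1 z.2 : Fin (k + 1) → ι))
    have h2 : (fun x i => g i x) =
        fun x => (Fin.cons (g 0 x) (fun i : Fin k => g i.succ x) : Fin (k + 1) → ι) := by
      funext x i
      refine Fin.cases ?_ (fun j => ?_) i <;> simp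
    rw [h2, Fin.sum_univ_succ]
    exact h1.trans ((valueEntropy_prod_le (hg 0) htail).trans
      (add_le_add le_rfl (ih fun i => hg i.succ)))

/-- If the joint distribution of `(g, g')` is close to the product distribution, then the entropy
of the pair is almost the sum of the entropies. -/
theorem exists_delta_valueEntropy_prod {g : X → ι} (hg : Measurable g) {a : X → κ}
    (ha : Measurable a) {η : ℝ} (hη : 0 < η) : ∃ δ > 0, ∀ g' : X → κ,
      (∀ k i, |μ.real (g ⁻¹' {i} ∩ g' ⁻¹' {k}) - μ.real (g ⁻¹' {i}) * μ.real (a ⁻¹' {k})| < δ) →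
        valueEntropy μ g + valueEntropy μ a - η < valueEntropy μ (fun x => (g x, g' x)) := by
  -- Entropy is continuous in the vector of cell masses, so `δ` depends only on the product
  -- distribution and not on `g'`.
  have hcont : Continuous fun p : ι × κ → ℝ => ∑ z, Real.negMulLog (p z) :=
    continuous_finsetSum _ fun z _ => Real.continuous_negMulLog.comp (continuous_apply z)
  let p₀ : ι × κ → ℝ := fun z => μ.real (g ⁻¹' {z.1}) * μ.real (a ⁻¹' {z.2})
  obtain ⟨δ, hδ, hball⟩ := Metric.continuousAt_iff.1 (hcont.continuousAt (x := p₀)) η hη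
  refine ⟨δ, hδ, fun g' hg' => ?_⟩
  have hp₀ : ∑ z, Real.negMulLog (p₀ z) = valueEntropy μ g + valueEntropy μ a := by
    simp only [p₀, Fintype.sum_prod_type, Real.negMulLog_mul, Finset.sum_add_distrib,
      ← Finset.sum_mul, ← Finset.mul_sum, sum_measureReal_fiber hg, sum_measureReal_fiber ha,
      valueEntropy, one_mul]
  have hdist : dist (fun z : ι × κ => μ.real ((fun x => (g x, g' x)) ⁻¹' {z})) p₀ < δ := by
    refine (dist_pi_lt_iff hδ).2 fun z => ?_
    have hz : (fun x => (g x, g' x)) ⁻¹' {z} = g ⁻¹' {z.1} ∩ g' ⁻¹' {z.2} := by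
      ext x; simp [Prod.ext_iff]
    rw [hz, Real.dist_eq]
    exact hg' z.2 z.1
  have h1 := hball hdist
  rw [Real.dist_eq, hp₀] at h1
  have h2 := (abs_lt.1 h1).1
  change _ < ∑ z, _
  linarith

open Classical in
theorem exists_delta_valueEntropy_mem_lt {η : ℝ} (hη : 0 < η) : ∃ δ > 0, ∀ E : Set X,
    MeasurableSet E → μ.real E < δ → valueEntropy μ (fun x => decide (x ∈ E)) < η := by
  have hcont : Continuous fun x : ℝ => Real.negMulLog x + Real.negMulLog (1 - x) := by
    have := Real.continuous_negMulLog
    fun_prop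
  obtain ⟨δ, hδ, hball⟩ := Metric.continuousAt_iff.1 (hcont.continuousAt (x := 0)) η hη
  refine ⟨δ, hδ, fun E hE hlt => ?_⟩
  have h1 := hball (x := μ.real E) (by
    rwa [Real.dist_eq, sub_zero, abs_of_nonneg measureReal_nonneg])
  rw [Real.dist_eq] at h1
  have ht : (fun x => decide (x ∈ E)) ⁻¹' {true} = E := by ext x; simp
  have hf : (fun x => decide (x ∈ E)) ⁻¹' {false} = Eᶜ := by ext x; simp
  rw [valueEntropy, Fintype.sum_bool, ht, hf, probReal_compl_eq_one_sub hE]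
  simpa using (abs_lt.1 h1).2

end Entropy

/-! ### Sequence entropy: greedy construction and vanishing on the Kronecker algebra. -/

section SequenceEntropy

/-- Recursive choice in which each term may depend on all its predecessors. -/
theorem exists_seq_of_forall_fin {W : Type*} {P : ∀ n : ℕ, (Fin n → W) → W → Prop}
    (h : ∀ n p, ∃ w, P n p w) : ∃ s : ℕ → W, ∀ n, P n (fun i => s i) (s n) := by
  choose F hF using h
  let p : ∀ n : ℕ, Fin n → W := fun n =>
    Nat.rec (motive := fun n => Fin n → W) Fin.elim0 (fun n q => Fin.snoc q (F n q)) n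
  have hp : ∀ n, (fun i : Fin n => F i (p i)) = p n := by
    intro n
    induction n with
    | zero => exact Subsingleton.elim _ _
    | succ n ih =>
      have hs : p (n + 1) = Fin.snoc (p n) (F n (p n)) := rfl
      rw [hs, ← ih]
      funext i
      refine Fin.lastCases ?_ (fun j => ?_) i
      · rw [Fin.snoc_last, ih]; rfl
      · rw [Fin.snoc_castSucc]; rfl
  exact ⟨fun n => F n (p n), fun n => by rw [hp n]; exact hF n (p n)⟩

variable {X : Type*} [MeasurableSpace X] [AddAction (ℤ × ℤ) X]
  {μ : Measure X}

theorem sequenceEntropy_eq_limsup_valueEntropy {ι : Type*} [Fintype ι] {A : ι → Set X} {a : X → ι}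
    (h : ∀ i, A i = a ⁻¹' {i}) (s : ℕ → ℤ × ℤ) :
    sequenceEntropy μ s A = limsup (fun k : ℕ => ((1 / (k : ℝ) *
      valueEntropy μ (fun x (i : Fin k) => a (s i +ᵥ x)) : ℝ) : EReal)) atTop := by
  rw [sequenceEntropy]
  congr 1
  funext k
  rw [partitionEntropy_eq_valueEntropy μ (g := fun x (i : Fin k) => a (s i +ᵥ x))]
  intro f
  ext x
  simp [sequenceJoin, h, funext_iff]

variable [MeasurableConstVAdd (ℤ × ℤ) X] [VAddInvariantMeasure (ℤ × ℤ) X μ]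
  [IsProbabilityMeasure μ] {β b₀ b : ℝ}

theorem IsDirectionalWeakMixing.exists_sequenceEntropy_pos
    (hwm : IsDirectionalWeakMixing μ β b₀) (hb : 0 < b) {ι : Type*} [Fintype ι]
    {A : ι → Set X} (hA : IsMeasurablePartition A) (hnt : ∃ i, 0 < μ (A i) ∧ μ (A i) < 1) :
    ∃ s : ℕ → ℤ × ℤ, IsDirectionalSequence β b s ∧ 0 < sequenceEntropy μ s A := by
  let _ : MeasurableSpace ι := ⊤
  obtain ⟨a, ha, hAa⟩ := hA.exists_label
  obtain ⟨i₀, hi₀, hi₁⟩ := hnt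
  have hpos : 0 < valueEntropy μ a := by
    refine valueEntropy_pos (i := i₀) ?_ ?_ <;> rw [← hAa]
    · exact ENNReal.toReal_pos hi₀.ne' (measure_ne_top μ _)
    · exact ENNReal.toReal_lt_of_lt_ofReal (by simpa using hi₁)
  set h : ℝ := valueEntropy μ a / 2 with hh
  have hh0 : 0 < h := half_pos hpos
  let V : ∀ n : ℕ, (Fin n → ℤ × ℤ) → X → Fin n → ι := fun n p x i => a (p i +ᵥ x)
  have hV : ∀ n p, Measurable (V n p) := fun n p =>
    measurable_pi_lambda _ fun i => ha.comp (measurable_const_vadd (p i))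
  -- Near independence from the past yields almost the full gain `2 * h`; only `h` is asked for,
  -- which leaves room for the error.
  obtain ⟨s, hs⟩ := exists_seq_of_forall_fin (W := ℤ × ℤ)
    (P := fun n p w => w ∈ directionalStrip β b ∧ (∀ i, (p i).1 < w.1) ∧
      valueEntropy μ (V n p) + h < valueEntropy μ (fun x => (V n p x, a (w +ᵥ x)))) (by
    intro n p
    obtain ⟨N₀, hN₀⟩ := Finite.exists_le fun i => (p i).1
    obtain ⟨δ, hδ, hclose⟩ := exists_delta_valueEntropy_prod (μ := μ) (hV n p) ha hh0
    obtain ⟨w, hw, hN, hlt⟩ := hwm.exists_measureReal_inter_lt hb (A := A) hA.measurableSet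
      (C := fun f => V n p ⁻¹' {f}) (fun f => hV n p (measurableSet_singleton f)) hδ N₀
    refine ⟨w, hw, fun i => (hN₀ i).trans_lt hN, ?_⟩
    have h1 := hclose (fun x => a (w +ᵥ x)) fun k f => by
      have h2 := hlt k f
      rw [hAa] at h2
      exact h2
    linarith)
  refine ⟨s, ⟨fun i => (hs i).1, Or.inl (strictMono_nat_of_lt_succ fun n =>
    (hs (n + 1)).2.1 (Fin.last n))⟩, ?_⟩
  have hstep : ∀ k : ℕ, k * h ≤ valueEntropy μ (V k fun i => s i) := by
    intro k
    induction k with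
    | zero => simpa using valueEntropy_nonneg _
    | succ k ih =>
      have h1 := (hs k).2.2
      have h2 := valueEntropy_comp_le (μ := μ) (hV (k + 1) fun i => s i)
        (fun f => ((fun i : Fin k => f i.castSucc), f (Fin.last k)))
      have h3 : (fun x => ((fun i : Fin k => V (k + 1) (fun i => s i) x i.castSucc),
          V (k + 1) (fun i => s i) x (Fin.last k))) =
          fun x => (V k (fun i => s i) x, a (s k +ᵥ x)) := by
        funext x; simp [V]
      rw [h3] at h2
      push_cast
      linarith
  rw [sequenceEntropy_eq_limsup_valueEntropy hAa]
  refine lt_of_lt_of_le (EReal.coe_pos.2 hh0) (le_limsup_of_frequently_le ?_)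
  refine Eventually.frequently ((eventually_gt_atTop 0).mono fun k hk => ?_)
  have hk' : (0 : ℝ) < k := by exact_mod_cast hk
  rw [EReal.coe_le_coe_iff, one_div, le_inv_mul_iff₀ hk']
  exact hstep k

open Classical in
theorem sequenceEntropy_nonpos_of_mem_directionalKronecker (hb₀ : 0 < b₀) {B : Set X}
    (hB : B ∈ directionalKronecker μ β b₀) {s : ℕ → ℤ × ℤ} (hs : ∀ i, s i ∈ directionalStrip β b) :
    sequenceEntropy μ s ![B, Bᶜ] ≤ 0 := by
  obtain ⟨hBm, htb⟩ := mem_directionalKronecker_iff.1 hB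
  have htb' := totallyBounded_orbit_directionalStrip (koopman_add μ) hb₀ htb b
  let T : ℤ × ℤ → Set X := fun w => (fun x => w +ᵥ x) ⁻¹' B
  have hT : ∀ w, MeasurableSet (T w) := fun w => hBm.preimage (measurable_const_vadd w)
  by_contra! hcon
  obtain ⟨η, hη0, hη⟩ := EReal.lt_iff_exists_real_btwn.1 hcon
  have hη0' : 0 < η / 2 := half_pos (EReal.coe_pos.1 hη0)
  obtain ⟨δ, hδ, hsmall⟩ := exists_delta_valueEntropy_mem_lt (μ := μ) hη0'
  -- The radius is `√δ` because the `L²` distance of two indicators is the square root of the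
  -- measure of the symmetric difference.
  obtain ⟨F, -, hF, hcov⟩ := Set.exists_subset_image_finite_and.1
    (Metric.finite_approx_of_totallyBounded htb' (√δ) (Real.sqrt_pos.2 hδ))
  have hnear : ∀ i, ∃ z ∈ F, μ.real (symmDiff (T (s i)) (T z)) < δ := by
    intro i
    obtain ⟨_, ⟨z, hz, rfl⟩, hlt⟩ := Set.mem_iUnion₂.1 (hcov ⟨s i, hs i, rfl⟩)
    refine ⟨z, hz, ?_⟩
    simp only [koopman_indicatorConstLp] at hlt
    rw [Metric.mem_ball, dist_indicatorConstLp_eq_norm,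
      norm_indicatorConstLp two_ne_zero ENNReal.ofNat_ne_top, norm_one, one_mul,
      ENNReal.toReal_ofNat, ← Real.sqrt_eq_rpow] at hlt
    exact (Real.sqrt_lt_sqrt_iff measureReal_nonneg).1 hlt
  choose z hzF hz using hnear
  have : Fintype F := hF.fintype
  let D : X → F → Bool := fun x w => decide (x ∈ T w)
  have hmem : ∀ {E : Set X}, MeasurableSet E → Measurable fun x => decide (x ∈ E) := fun hE =>
    measurable_to_bool (by convert hE; ext x; simp)
  have hD : Measurable D := measurable_pi_lambda _ fun w => hmem (hT w)
  let E : ∀ k : ℕ, X → Fin k → Bool := fun k x i => decide (x ∈ symmDiff (T (s i)) (T (z i)))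
  have hEi : ∀ i, MeasurableSet (symmDiff (T (s i)) (T (z i))) := fun i => (hT _).symmDiff (hT _)
  have hE : ∀ k, Measurable (E k) := fun k => measurable_pi_lambda _ fun i => hmem (hEi i)
  let a : X → Fin 2 := fun x => if x ∈ B then 0 else 1
  have ha : ∀ i, ![B, Bᶜ] i = a ⁻¹' {i} := by
    intro i
    ext x
    fin_cases i <;> by_cases hx : x ∈ B <;> simp [a, hx]
  have hbound : ∀ k : ℕ, valueEntropy μ (fun x (i : Fin k) => a (s i +ᵥ x)) ≤
      valueEntropy μ D + k * (η / 2) := by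
    intro k
    -- The label at time `i` is the exclusive or of membership in the approximating set and in the
    -- error set. Only the error sets grow in number with `k`.
    have h1 := valueEntropy_comp_le (μ := μ) (hD.prodMk (hE k))
      (fun q (i : Fin k) => if xor (q.2 i) (q.1 ⟨z i, hzF i⟩) then (0 : Fin 2) else 1)
    have h2 : (fun x (i : Fin k) => if xor (E k x i) (D x ⟨z i, hzF i⟩) then (0 : Fin 2) else 1) =
        fun x (i : Fin k) => a (s i +ᵥ x) := by
      funext x i
      by_cases h3 : s i +ᵥ x ∈ B <;> by_cases h4 : z i +ᵥ x ∈ B <;>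
        simp [a, E, D, T, Set.mem_symmDiff, h3, h4]
    have h3 : valueEntropy μ (E k) ≤ k * (η / 2) := by
      refine (valueEntropy_pi_le fun i => hmem (hEi i)).trans ?_
      refine (Finset.sum_le_card_nsmul _ _ (η / 2) fun i _ => (hsmall _ (hEi _) (hz _)).le).trans ?_
      simp
    rw [h2] at h1
    linarith [valueEntropy_prod_le (μ := μ) hD (hE k)]
  refine hη.not_ge ?_
  rw [sequenceEntropy_eq_limsup_valueEntropy ha]
  refine limsup_le_of_le (by isBoundedDefault) ?_
  obtain ⟨k₀, hk₀⟩ := exists_nat_gt (valueEntropy μ D / (η / 2))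
  filter_upwards [eventually_ge_atTop k₀, eventually_gt_atTop 0] with k hk hk0
  have hk' : (0 : ℝ) < k := by exact_mod_cast hk0
  rw [EReal.coe_le_coe_iff, one_div, inv_mul_le_iff₀ hk']
  rw [div_lt_iff₀ hη0'] at hk₀
  have h1 : (k₀ : ℝ) * (η / 2) ≤ k * (η / 2) := by gcongr
  linarith [hbound k]

theorem isDirectionalWeakMixing_of_sequenceEntropy_pos (hb₀ : 0 < b₀)
    (h : ∀ B : Set X, MeasurableSet B → 0 < μ B → μ B < 1 →
      ∃ s : ℕ → ℤ × ℤ, IsDirectionalSequence β b s ∧ 0 < sequenceEntropy μ s ![B, Bᶜ]) :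
    IsDirectionalWeakMixing μ β b₀ := by
  intro B hB
  have hBm : MeasurableSet B := hB.1
  by_contra! hcon
  obtain ⟨s, hs, hpos⟩ := h B hBm (pos_iff_ne_zero.2 hcon.1)
    (lt_of_le_of_ne prob_le_one fun h1 => hcon.2 ((prob_compl_eq_zero_iff hBm).2 h1))
  exact hpos.not_ge (sequenceEntropy_nonpos_of_mem_directionalKronecker hb₀ hB hs.mem_strip)

end SequenceEntropy

/-! ### The equivalences. -/

theorem mainTheorem2 {X : Type*} [MetricSpace X] [CompactSpace X] [MeasurableSpace X]
    [BorelSpace X] [AddAction (ℤ × ℤ) X] [ContinuousConstVAdd (ℤ × ℤ) X]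
    (μ : Measure X) [IsProbabilityMeasure μ] [VAddInvariantMeasure (ℤ × ℤ) X μ]
    (β b₀ : ℝ) (hb₀ : 0 < b₀) :
    List.TFAE [
      IsDirectionalWeakMixing μ β b₀,
      ∀ B : Set X, MeasurableSet B → 0 < μ B → μ B < 1 → ∀ b : ℝ, 0 < b →
        ∃ s : ℕ → ℤ × ℤ, IsDirectionalSequence β b s ∧ 0 < sequenceEntropy μ s ![B, Bᶜ],
      ∀ (r : ℕ) (A : Fin r → Set X), IsMeasurablePartition A →
        (∃ i, 0 < μ (A i) ∧ μ (A i) < 1) → ∀ b : ℝ, 0 < b →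
        ∃ s : ℕ → ℤ × ℤ, IsDirectionalSequence β b s ∧ 0 < sequenceEntropy μ s A] ∧
    ∀ b : ℝ, 0 < b → List.TFAE [
      IsDirectionalWeakMixing μ β b₀,
      ∀ B : Set X, MeasurableSet B → 0 < μ B → μ B < 1 →
        ∃ s : ℕ → ℤ × ℤ, IsDirectionalSequence β b s ∧ 0 < sequenceEntropy μ s ![B, Bᶜ],
      ∀ (r : ℕ) (A : Fin r → Set X), IsMeasurablePartition A →
        (∃ i, 0 < μ (A i) ∧ μ (A i) < 1) →
        ∃ s : ℕ → ℤ × ℤ, IsDirectionalSequence β b s ∧ 0 < sequenceEntropy μ s A] := by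
  refine ⟨?_, fun b hb => ?_⟩
  · tfae_have 1 → 3 := fun h r A hA hnt b hb => h.exists_sequenceEntropy_pos hb hA hnt
    tfae_have 3 → 2 := fun h B hB h0 h1 b hb =>
      h 2 _ (isMeasurablePartition_compl hB) ⟨0, h0, h1⟩ b hb
    -- The width `1` is arbitrary: any positive value would do.
    tfae_have 2 → 1 := fun h => isDirectionalWeakMixing_of_sequenceEntropy_pos hb₀
      fun B hB h0 h1 => h B hB h0 h1 1 one_pos
    tfae_finish
  · tfae_have 1 → 3 := fun h r A hA hnt => h.exists_sequenceEntropy_pos hb hA hnt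
    tfae_have 3 → 2 := fun h B hB h0 h1 => h 2 _ (isMeasurablePartition_compl hB) ⟨0, h0, h1⟩
    tfae_have 2 → 1 := fun h => isDirectionalWeakMixing_of_sequenceEntropy_pos hb₀ h
    tfae_finish
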